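/- Let $A_0$ be a nonnegative self-adjoint operator (unbounded, as it must be as soon as $n\ge 1$ below) in a complex Hilbert space $\mathfrak H$, with inner product $(\cdot,\cdot)$ linear in the first argument. Let $\mathfrak H_2=\mathcal D(A_0)$ with norm $\|(A_0+I)u\|$, let $\mathfrak H_1=\mathcal D(A_0^{1/2})=\mathcal D((A_0+I)^{1/2})$ with norm $\|(A_0+I)^{1/2}u\|$, and let $\mathfrak H_{-1}\subset\mathfrak H_{-2}$ be the dual spaces, whose elements are regarded as linear functionals $\langle\psi,\cdot\rangle$ on $\mathfrak H_2$ (those bounded for the norm of $\mathfrak H_1$, respectively of $\mathfrak H_2$); $v\in\mathfrak H$ is identified with the functional $u\mapsto(u,v)$. For $\psi\in\mathfrak H_{-2}$ let $(\mathbb A_0+I)^{-1}\psi$ be the unique $h\in\mathfrak H$ with $\langle\psi,u\rangle=((A_0+I)u,h)$ for all $u\in\mathcal D(A_0)$. Let $n\in\mathbb N$, let $\psi_1,\dots,\psi_n\in\mathfrak H_{-2}$ be linearly independent with $\operatorname{span}\{\psi_1,\dots,\psi_n\}\cap\mathfrak H=\{0\}$, and consider the formal expression $A_0+\sum_{i,j=1}^n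 b_{ij}\langle\psi_j,\cdot\rangle\psi_i$, $b_{ij}\in\mathbb C$. Let $A_{\rm sym}$ be the closed densely defined nonnegative symmetric operator obtained by restricting $A_0$ to $\{u\in\mathcal D(A_0):\langle\psi_j,u\rangle=0,\ 1\le j\le n\}$. With $h_j=(\mathbb A_0+I)^{-1}\psi_j$, every $f\in\mathcal D(A_{\rm sym}^*)$ is uniquely of the form $f=u+\sum_{p}\alpha_p h_p$ with $u\in\mathcal D(A_0)$ and $\alpha_p\in\mathbb C$. For a Hermitian matrix $\mathbf R=(r_{jp})_{j,p=1}^n$ put $$\langle\psi_j^{\rm ex},f\rangle=\langle\psi_j,u\rangle+\sum_{p=1}^n r_{jp}\alpha_p,\qquad f=u+\sum_{p=1}^n\alpha_p h_p\in\mathcal D(A_{\rm sym}^*).$$ The matrix $\mathbf R$ is called admissible if, whenever $c_1,\dots,c_n\in\mathbb C$ are such that $\psi=\sum_j c_j\psi_j$ (a linear combination of functionals) belongs to $\mathfrak H_{-1}$, one has, with $h=(\mathbb A_0+I)^{-1}\psi\in\mathfrak H_1$, $$\sum_{j=1}^n c_j\langle\psi_j^{\rm ex},f\rangle=\big((A_0+I)^{1/2}f,(A_0+I)^{1/2}h\big)\qquad\text{for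 all } f\in\mathcal D(A_{\rm sym}^*)\cap\mathfrak H_1 .$$ An operator $\widetilde A$ is called admissible (for the regularization of the above expression; this does not depend on the $b_{ij}$) if, for some admissible Hermitian matrix $\mathbf R$, it is the restriction of $A_{\rm sym}^*$ to $\{f\in\mathcal D(A_{\rm sym}^*):\langle\psi_j^{\rm ex},f\rangle=0,\ 1\le j\le n\}$. **Theorem.** There exists a nonnegative admissible operator $\widetilde A$ if and only if the Friedrichs extension $A_F$ and the Krein–von Neumann extension $A_N$ of $A_{\rm sym}$ are transversal, that is, $\mathcal D(A_F)+\mathcal D(A_N)=\mathcal D(A_{\rm sym}^*)$. Here $A_F$ and $A_N$ are the restrictions of $A_{\rm sym}^*$ to the sets of those $f\in\mathcal D(A_{\rm sym}^*)$ for which there are $u_k\in\mathcal D(A_{\rm sym})$ such that $(A_{\rm sym}(u_k-u_m),u_k-u_m)\to0$ as $k,m\to\infty$ and, for $A_F$, $u_k\to f$, respectively, for $A_N$, $A_{\rm sym}u_k\to A_{\rm sym}^*f$. -/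

import Mathlib

noncomputable section

namespace SingularPerturbation

open Filter Topology
open scoped LinearPMap

variable {H : Type*} [NormedAddCommGroup H] [InnerProductSpace ℂ H]

/-- The operator `T + I`, with domain `D(T)`. -/
abbrev addId (T : H →ₗ.[ℂ] H) : H →ₗ.[ℂ] H := (LinearMap.id : H →ₗ[ℂ] H) +ᵥ T

/-- Nonnegativity of an operator, `(T u, u) ≥ 0` on `D(T)` (used for symmetric `T`, for which the
inner product below is real). -/
def IsNonneg (T : H →ₗ.[ℂ] H) : Prop :=
  ∀ u : T.domain, 0 ≤ (inner ℂ (T u) (u : H)).re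

/-- The quadratic form `q[u] = (S u, u)` on `D(S)`. -/
def qform (S : H →ₗ.[ℂ] H) (u : S.domain) : ℝ := (inner ℂ (S u) (u : H)).re

/-- A sequence in `D(S)` is Cauchy for the form of `S`: `q[u_k - u_m] → 0` as `k, m → ∞`. -/
def FormCauchy (S : H →ₗ.[ℂ] H) (u : ℕ → S.domain) : Prop :=
  Tendsto (fun p : ℕ × ℕ => qform S (u p.1 - u p.2)) atTop (𝓝 0)

theorem qform_add_le {S : H →ₗ.[ℂ] H} (hS : IsNonneg S) (u v : S.domain) :
    qform S (u + v) ≤ 2 * qform S u + 2 * qform S v := by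
  have h : 0 ≤ qform S (u - v) := hS (u - v)
  have e : qform S (u + v) + qform S (u - v) = 2 * qform S u + 2 * qform S v := by
    simp only [qform, LinearPMap.map_add, LinearPMap.map_sub, Submodule.coe_add,
      Submodule.coe_sub, inner_add_left, inner_add_right, inner_sub_left, inner_sub_right,
      Complex.add_re, Complex.sub_re]
    ring
  linarith

theorem qform_smul {S : H →ₗ.[ℂ] H} (c : ℂ) (u : S.domain) :
    qform S (c • u) = ‖c‖ ^ 2 * qform S u := by
  have : (starRingEnd ℂ) c * c = ((‖c‖ ^ 2 : ℝ) : ℂ) := by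
    rw [mul_comm, Complex.mul_conj, Complex.normSq_eq_norm_sq]
  simp only [qform, LinearPMap.map_smul, Submodule.coe_smul, inner_smul_left, inner_smul_right]
  rw [← mul_assoc, mul_comm c, this, Complex.re_ofReal_mul]

theorem FormCauchy.zero {S : H →ₗ.[ℂ] H} : FormCauchy S (fun _ => 0) := by
  simp [FormCauchy, qform]

theorem FormCauchy.add {S : H →ₗ.[ℂ] H} (hS : IsNonneg S) {u v : ℕ → S.domain}
    (hu : FormCauchy S u) (hv : FormCauchy S v) : FormCauchy S (fun k => u k + v k) := by
  have h := (hu.const_mul 2).add (hv.const_mul 2)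
  simp only [mul_zero, add_zero] at h
  refine squeeze_zero (fun p => hS _) (fun p => ?_) h
  have e : u p.1 + v p.1 - (u p.2 + v p.2) = (u p.1 - u p.2) + (v p.1 - v p.2) := by abel
  rw [e]
  exact qform_add_le hS _ _

theorem FormCauchy.smul {S : H →ₗ.[ℂ] H} {u : ℕ → S.domain} (c : ℂ)
    (hu : FormCauchy S u) : FormCauchy S (fun k => c • u k) := by
  have h := hu.const_mul (‖c‖ ^ 2)
  simp only [mul_zero] at h
  refine h.congr (fun p => ?_)
  rw [← smul_sub, qform_smul]

section Complete

variable [CompleteSpace H]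

/-- The Friedrichs extension of a densely defined nonnegative symmetric operator `S`: the
restriction of `S*` to the `f ∈ D(S*)` for which there are `u_k ∈ D(S)` with `u_k → f` and
`(S (u_k - u_m), u_k - u_m) → 0`. -/
def friedrichs (S : H →ₗ.[ℂ] H) (hS : IsNonneg S) : H →ₗ.[ℂ] H :=
  S†.domRestrict
    { carrier := {f | f ∈ S†.domain ∧ ∃ u : ℕ → S.domain,
        Tendsto (fun k => (u k : H)) atTop (𝓝 f) ∧ FormCauchy S u}
      zero_mem' := ⟨S†.domain.zero_mem, fun _ => 0, by simp, FormCauchy.zero⟩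
      add_mem' := by
        rintro f g ⟨hf, u, hu, cu⟩ ⟨hg, v, hv, cv⟩
        exact ⟨S†.domain.add_mem hf hg, fun k => u k + v k, by simpa using hu.add hv, cu.add hS cv⟩
      smul_mem' := by
        rintro c f ⟨hf, u, hu, cu⟩
        exact ⟨S†.domain.smul_mem c hf, fun k => c • u k, by simpa using hu.const_smul c,
          cu.smul c⟩ }

/-- The Krein-von Neumann extension of a densely defined nonnegative symmetric operator `S`: the
restriction of `S*` to the `f ∈ D(S*)` for which there are `u_k ∈ D(S)` with `S u_k → S* f` and
`(S (u_k - u_m), u_k - u_m) → 0`. -/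
def kreinVonNeumann (S : H →ₗ.[ℂ] H) (hS : IsNonneg S) : H →ₗ.[ℂ] H :=
  S†.domRestrict
    { carrier := {f | ∃ hf : f ∈ S†.domain, ∃ u : ℕ → S.domain,
        Tendsto (fun k => S (u k)) atTop (𝓝 (S† ⟨f, hf⟩)) ∧ FormCauchy S u}
      zero_mem' := by
        refine ⟨S†.domain.zero_mem, fun _ => 0, ?_, FormCauchy.zero⟩
        have e : S† ⟨0, S†.domain.zero_mem⟩ = 0 := S†.map_zero
        simp [e]
      add_mem' := by
        rintro f g ⟨hf, u, hu, cu⟩ ⟨hg, v, hv, cv⟩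
        refine ⟨S†.domain.add_mem hf hg, fun k => u k + v k, ?_, cu.add hS cv⟩
        have e : S† ⟨f + g, S†.domain.add_mem hf hg⟩ = S† ⟨f, hf⟩ + S† ⟨g, hg⟩ :=
          S†.map_add ⟨f, hf⟩ ⟨g, hg⟩
        simpa only [LinearPMap.map_add, e] using hu.add hv
      smul_mem' := by
        rintro c f ⟨hf, u, hu, cu⟩
        refine ⟨S†.domain.smul_mem c hf, fun k => c • u k, ?_, cu.smul c⟩
        have e : S† ⟨c • f, S†.domain.smul_mem c hf⟩ = c • S† ⟨f, hf⟩ :=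
          S†.map_smul c ⟨f, hf⟩
        simpa only [LinearPMap.map_smul, e] using hu.const_smul c }

/-- Two extensions `T₁`, `T₂` of `S` are transversal: `D(T₁) + D(T₂) = D(S*)`. -/
def Transversal (S T₁ T₂ : H →ₗ.[ℂ] H) : Prop :=
  T₁.domain ⊔ T₂.domain = S†.domain

/-- `B` is a nonnegative self-adjoint square root of `T`: `B ∘ B = T`, domains included. -/
def IsNonnegSqrt (T B : H →ₗ.[ℂ] H) : Prop :=
  IsSelfAdjoint B ∧ IsNonneg B ∧
    ∀ x y : H, (x, y) ∈ T.graph ↔ ∃ z : H, (x, z) ∈ B.graph ∧ (z, y) ∈ B.graph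

open scoped Classical in
/-- `T^{1/2}`: the (unique) nonnegative self-adjoint square root of a nonnegative self-adjoint
operator `T`. -/
def opSqrt (T : H →ₗ.[ℂ] H) : H →ₗ.[ℂ] H :=
  if h : ∃ B, IsNonnegSqrt T B then h.choose else 0

/-- The energy space `ℌ₁(A₀) = D((A₀ + I)^{1/2}) = D(A₀^{1/2})`, as a subspace of `H`. -/
abbrev energySpace (A₀ : H →ₗ.[ℂ] H) : Submodule ℂ H := (opSqrt (addId A₀)).domain

end Complete

/-! The negative spaces `ℌ₋₂(A₀) ⊇ ℌ₋₁(A₀) ⊇ H` of the scale of `A₀`, as spaces of linear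
functionals on `ℌ₂(A₀) = D(A₀)`; the value `ψ u` is the duality bracket `<ψ, u>`. -/

/-- `ℌ₋₂(A₀)`, the dual of `ℌ₂(A₀)`: the functionals on `D(A₀)` that are bounded with respect to
the norm `‖(A₀ + I) u‖`. -/
def hMinusTwo (A₀ : H →ₗ.[ℂ] H) : Submodule ℂ (Module.Dual ℂ A₀.domain) where
  carrier := {ψ | ∃ C : ℝ, ∀ u : A₀.domain, ‖ψ u‖ ≤ C * ‖addId A₀ u‖}
  zero_mem' := ⟨0, fun u => by simp⟩
  add_mem' := by
    rintro φ ψ ⟨C, hC⟩ ⟨D, hD⟩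
    refine ⟨C + D, fun u => ?_⟩
    rw [LinearMap.add_apply, add_mul]
    exact (norm_add_le _ _).trans (add_le_add (hC u) (hD u))
  smul_mem' := by
    rintro c ψ ⟨C, hC⟩
    refine ⟨‖c‖ * C, fun u => ?_⟩
    rw [LinearMap.smul_apply, norm_smul, mul_assoc]
    exact mul_le_mul_of_nonneg_left (hC u) (norm_nonneg c)

/-- `ℌ₋₁(A₀)`, the dual of `ℌ₁(A₀)`, in which `D(A₀)` is dense: the functionals on `D(A₀)` that are
bounded with respect to the norm `‖(A₀ + I)^{1/2} u‖ = ((A₀ + I) u, u)^{1/2}`. -/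
def hMinusOne (A₀ : H →ₗ.[ℂ] H) : Submodule ℂ (Module.Dual ℂ A₀.domain) where
  carrier := {ψ | ∃ C : ℝ, ∀ u : A₀.domain,
    ‖ψ u‖ ≤ C * Real.sqrt (inner ℂ (addId A₀ u) (u : H)).re}
  zero_mem' := ⟨0, fun u => by simp⟩
  add_mem' := by
    rintro φ ψ ⟨C, hC⟩ ⟨D, hD⟩
    refine ⟨C + D, fun u => ?_⟩
    rw [LinearMap.add_apply, add_mul]
    exact (norm_add_le _ _).trans (add_le_add (hC u) (hD u))
  smul_mem' := by
    rintro c ψ ⟨C, hC⟩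
    refine ⟨‖c‖ * C, fun u => ?_⟩
    rw [LinearMap.smul_apply, norm_smul, mul_assoc]
    exact mul_le_mul_of_nonneg_left (hC u) (norm_nonneg c)

/-- `H` inside `ℌ₋₂(A₀)`: the functionals `u ↦ (u, v)` with `v ∈ H`. (Mathlib's inner product
is linear in the second argument.) -/
def hZero (A₀ : H →ₗ.[ℂ] H) : Submodule ℂ (Module.Dual ℂ A₀.domain) where
  carrier := {ψ | ∃ v : H, ∀ u : A₀.domain, ψ u = inner ℂ v (u : H)}
  zero_mem' := ⟨0, fun u => by simp⟩
  add_mem' := by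
    rintro φ ψ ⟨v, hv⟩ ⟨w, hw⟩
    exact ⟨v + w, fun u => by rw [LinearMap.add_apply, hv, hw, inner_add_left]⟩
  smul_mem' := by
    rintro c ψ ⟨v, hv⟩
    exact ⟨(starRingEnd ℂ) c • v, fun u => by
      rw [LinearMap.smul_apply, hv, inner_smul_left, Complex.conj_conj, smul_eq_mul]⟩

open scoped Classical in
/-- The extended resolvent `(𝔸₀ + I)⁻¹ : ℌ₋₂(A₀) → H`: the (unique) `h ∈ H` with
`<ψ, u> = ((A₀ + I) u, h)` for all `u ∈ D(A₀)`. -/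
def extResolvent (A₀ : H →ₗ.[ℂ] H) (ψ : Module.Dual ℂ A₀.domain) : H :=
  if h : ∃ h : H, ∀ u : A₀.domain, ψ u = inner ℂ h (addId A₀ u) then h.choose else 0

variable {n : ℕ}

/-- `A_sym`: the restriction of `A₀` to `{u ∈ D(A₀) : <ψ_j, u> = 0 for all j}`. -/
def symRestriction (A₀ : H →ₗ.[ℂ] H) (ψ : Fin n → Module.Dual ℂ A₀.domain) : H →ₗ.[ℂ] H :=
  A₀.domRestrict ((⨅ j, LinearMap.ker (ψ j)).map A₀.domain.subtype)

theorem symRestriction_isNonneg {A₀ : H →ₗ.[ℂ] H} (h₀ : IsNonneg A₀)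
    (ψ : Fin n → Module.Dual ℂ A₀.domain) : IsNonneg (symRestriction A₀ ψ) := by
  intro u
  have e : symRestriction A₀ ψ u = A₀ ⟨u, u.2.2⟩ := LinearPMap.domRestrict_apply rfl
  rw [e]
  exact h₀ ⟨u, u.2.2⟩

/-- `(u, α) ↦ u + ∑ₚ αₚ hₚ` with `hₚ = (𝔸₀ + I)⁻¹ ψₚ`. -/
def assemble (A₀ : H →ₗ.[ℂ] H) (ψ : Fin n → Module.Dual ℂ A₀.domain) :
    A₀.domain × (Fin n → ℂ) →ₗ[ℂ] H :=
  A₀.domain.subtype.coprod (Fintype.linearCombination ℂ (fun p => extResolvent A₀ (ψ p)))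

/-- The values `<ψ_jᵉˣ, f> = <ψ_j, u> + ∑ₚ r_{jp} αₚ` (that is, `Γ₀ f`) of the extended functionals
at `f = u + ∑ₚ αₚ hₚ`, as a function of the pair `(u, α)`. -/
def extFunctionals (A₀ : H →ₗ.[ℂ] H) (ψ : Fin n → Module.Dual ℂ A₀.domain)
    (R : Matrix (Fin n) (Fin n) ℂ) : A₀.domain × (Fin n → ℂ) →ₗ[ℂ] (Fin n → ℂ) :=
  (LinearMap.pi ψ).coprod R.mulVecLin

variable [CompleteSpace H]

/-- Admissible matrices: `R` is Hermitian, and whenever `ψ = ∑ⱼ cⱼ ψⱼ` lies in `ℌ₋₁(A₀)`, then with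
`h = (𝔸₀ + I)⁻¹ ψ` (an element of `ℌ₁(A₀)`) one has
`∑ⱼ cⱼ <ψ_jᵉˣ, f> = ((A₀ + I)^{1/2} f, (A₀ + I)^{1/2} h)` for all `f ∈ D(A_sym*) ∩ ℌ₁(A₀)`. -/
def IsAdmissibleMatrix (A₀ : H →ₗ.[ℂ] H) (ψ : Fin n → Module.Dual ℂ A₀.domain)
    (R : Matrix (Fin n) (Fin n) ℂ) : Prop :=
  R.IsHermitian ∧
    ∀ c : Fin n → ℂ, (∑ j, c j • ψ j) ∈ hMinusOne A₀ →
      ∃ hh : extResolvent A₀ (∑ j, c j • ψ j) ∈ energySpace A₀,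
        ∀ (f : H) (hf : f ∈ energySpace A₀), f ∈ (symRestriction A₀ ψ)†.domain →
          ∀ p : A₀.domain × (Fin n → ℂ), f = assemble A₀ ψ p →
            ∑ j, c j * extFunctionals A₀ ψ R p j =
              inner ℂ (opSqrt (addId A₀) ⟨extResolvent A₀ (∑ j, c j • ψ j), hh⟩)
                (opSqrt (addId A₀) ⟨f, hf⟩)

/-- The operator `Ã` of a matrix `R`: the restriction of `A_sym*` to
`ker Γ₀ = {f = u + ∑ₚ αₚ hₚ : <ψ_jᵉˣ, f> = 0 for all j}`. -/
def matrixOperator (A₀ : H →ₗ.[ℂ] H) (ψ : Fin n → Module.Dual ℂ A₀.domain)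
    (R : Matrix (Fin n) (Fin n) ℂ) : H →ₗ.[ℂ] H :=
  (symRestriction A₀ ψ)†.domRestrict
    ((LinearMap.ker (extFunctionals A₀ ψ R)).map (assemble A₀ ψ))

/-- Admissible operators for the regularization of `A₀ + ∑ b_{ij} <ψ_j, ·> ψ_i`. -/
def IsAdmissibleOperator (A₀ : H →ₗ.[ℂ] H) (ψ : Fin n → Module.Dual ℂ A₀.domain)
    (T : H →ₗ.[ℂ] H) : Prop :=
  ∃ R : Matrix (Fin n) (Fin n) ℂ, IsAdmissibleMatrix A₀ ψ R ∧ T = matrixOperator A₀ ψ R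

end SingularPerturbation

end

noncomputable section

set_option linter.unusedSectionVars false

/-! Write `S` for `A_sym` and `q` for its form, and call `f ∈ D(S*)` form-bounded if `|(f, S u)| ≤ C
q[u]^{1/2}` on `D(S)`. Both sides of the equivalence say that every element of `D(S*)` is
form-bounded.

Elements of `D(A_F)` and `D(A_N)` are form-bounded: if `J` maps `D(S)` into the completion for `q`
and `a = lim J u_k`, then `(f, S w) = (a, J w)`. Conversely (`transversal_of_bound`), anything
orthogonal to `D(A_F) + D(A_N)` in the boundary form `(S* f, g) - (f, S* g)` lies in `D(A_F) ∩
D(A_N)`, because both operators are symmetric and become onto after adding `I`. Such an element is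
orthogonal to all form-bounded elements (`boundary_form_eq_of_mem_inf`). Since the boundary form is
nondegenerate on the finite-dimensional space `D(S*)/D(S)`, the sum is everything.

If `Ã` is nonnegative, Cauchy-Schwarz for the forms of `A₀` and `Ã` makes both domains form-bounded,
and their sum is `D(S*)`.

If `A_F` and `A_N` are transversal, admissibility fixes `R` only on the part of the defect space in
the energy space, where it must be the energy Gram matrix. On a complement `R` is taken negative
enough. Form-boundedness of the `h_j` controls the cross terms, and `(Ã f, f) ≥ 0` follows by
completing a square. -/

namespace SingularPerturbation

open Filter Topology
open scoped LinearPMap InnerProductSpace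

/-! ### Hilbert space tools: completing a form, projecting onto a graph -/

section Realization

universe u

/-- A positive semidefinite form `(ι u, T v)` is the inner product of a Hilbert space in which the
given vector space is densely mapped. -/
theorem exists_dense_realization {H : Type u} [NormedAddCommGroup H] [InnerProductSpace ℂ H]
    {D : Type u} [AddCommGroup D] [Module ℂ D] (ι T : D →ₗ[ℂ] H)
    (hsym : ∀ x y, inner ℂ (T x) (ι y) = inner ℂ (ι x) (T y))
    (hpos : ∀ x, 0 ≤ (inner ℂ (T x) (ι x)).re) :
    ∃ (K : Type u) (_ : NormedAddCommGroup K) (_ : InnerProductSpace ℂ K) (_ : CompleteSpace K)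
      (J : D →ₗ[ℂ] K), DenseRange J ∧ ∀ x y, inner ℂ (J x) (J y) = inner ℂ (ι x) (T y) := by
  let c : PreInnerProductSpace.Core ℂ D :=
    { inner := fun x y => inner ℂ (ι x) (T y)
      conj_inner_symm := fun x y => by rw [inner_conj_symm, hsym]
      re_inner_nonneg := fun x => by rw [← hsym]; exact hpos x
      add_left := fun x y z => by rw [map_add, inner_add_left]
      smul_left := fun x y r => by rw [map_smul, inner_smul_left] }
  let : SeminormedAddCommGroup D := InnerProductSpace.Core.toSeminormedAddCommGroup (c := c)
  let : InnerProductSpace ℂ D := InnerProductSpace.ofCore c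
  -- The completion is separated, so vectors of zero form need not be factored out beforehand.
  refine ⟨UniformSpace.Completion D, inferInstance, inferInstance, inferInstance,
    (UniformSpace.Completion.toComplL (𝕜 := ℂ) (E := D)).toLinearMap, ?_, ?_⟩
  · exact UniformSpace.Completion.denseRange_coe
  · intro x y
    exact UniformSpace.Completion.inner_coe x y

/-- Projection of `(0, g)` to the closure of `{(J u, E u)}`. -/
theorem exists_seq_tendsto_inner_eq {H K D : Type*} [NormedAddCommGroup H] [InnerProductSpace ℂ H]
    [CompleteSpace H] [NormedAddCommGroup K] [InnerProductSpace ℂ K] [CompleteSpace K]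
    [AddCommGroup D] [Module ℂ D] (J : D →ₗ[ℂ] K) (E : D →ₗ[ℂ] H) (g : H) :
    ∃ (v : ℕ → D) (a : K) (e : H), Tendsto (fun k => J (v k)) atTop (𝓝 a) ∧
      Tendsto (fun k => E (v k)) atTop (𝓝 e) ∧
      ∀ u, inner ℂ a (J u) + inner ℂ e (E u) = inner ℂ g (E u) := by
  let F : D →ₗ[ℂ] WithLp 2 (K × H) := (WithLp.linearEquiv 2 ℂ (K × H)).symm.toLinearMap ∘ₗ J.prod E
  let M := (LinearMap.range F).topologicalClosure
  let z : WithLp 2 (K × H) := WithLp.toLp 2 (0, g)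
  let p : M := M.orthogonalProjectionOnto z
  have hp : (p : WithLp 2 (K × H)) ∈ closure (LinearMap.range F : Set (WithLp 2 (K × H))) := p.2
  obtain ⟨s, hs, hlim⟩ := mem_closure_iff_seq_limit.1 hp
  choose v hv using hs
  have h2 := ((WithLp.prod_continuous_ofLp 2 K H).tendsto _).comp hlim
  refine ⟨v, (p : WithLp 2 (K × H)).fst, (p : WithLp 2 (K × H)).snd, ?_, ?_, ?_⟩
  · have := (continuous_fst.tendsto _).comp h2
    refine this.congr fun k => ?_
    simp only [Function.comp, ← hv]; rfl
  · have := (continuous_snd.tendsto _).comp h2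
    refine this.congr fun k => ?_
    simp only [Function.comp, ← hv]; rfl
  · intro u
    have hu : F u ∈ M := Submodule.le_topologicalClosure _ ⟨u, rfl⟩
    have h := Submodule.sub_starProjection_mem_orthogonal (K := M) z
    have h3 := Submodule.inner_left_of_mem_orthogonal hu h
    rw [inner_sub_left, sub_eq_zero, WithLp.prod_inner_apply, WithLp.prod_inner_apply] at h3
    have e : inner ℂ (0 : K) (J u) + inner ℂ g (E u) = _ := h3
    rw [inner_zero_left, zero_add] at e
    exact e.symm

end Realization

/-! ### Form limits, adjoints and the boundary form -/

variable {H : Type*} [NormedAddCommGroup H] [InnerProductSpace ℂ H] [CompleteSpace H]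

/-- `‖J u‖² = q[u]` when `J` realizes the form of `S`. -/
theorem norm_sq_eq_qform {S : H →ₗ.[ℂ] H} {K : Type*} [NormedAddCommGroup K]
    [InnerProductSpace ℂ K] {J : S.domain →ₗ[ℂ] K}
    (hJ : ∀ x y, inner ℂ (J x) (J y) = inner ℂ (x : H) (S y)) (u : S.domain) :
    ‖J u‖ ^ 2 = qform S u := by
  rw [← inner_self_eq_norm_sq (𝕜 := ℂ), hJ, qform]
  exact (inner_re_symm (𝕜 := ℂ) _ _)

theorem formCauchy_iff_cauchySeq {S : H →ₗ.[ℂ] H} {K : Type*} [NormedAddCommGroup K]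
    [InnerProductSpace ℂ K] {J : S.domain →ₗ[ℂ] K}
    (hJ : ∀ x y, inner ℂ (J x) (J y) = inner ℂ (x : H) (S y)) (u : ℕ → S.domain) :
    FormCauchy S u ↔ CauchySeq (fun k => J (u k)) := by
  rw [cauchySeq_iff_tendsto_dist_atTop_0, FormCauchy]
  have e : ∀ p : ℕ × ℕ, qform S (u p.1 - u p.2) = dist (J (u p.1)) (J (u p.2)) ^ 2 := fun p => by
    rw [dist_eq_norm, ← map_sub, norm_sq_eq_qform hJ]
  simp only [e]
  constructor
  · intro h
    have := h.sqrt
    simpa [Real.sqrt_sq dist_nonneg] using this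
  · intro h
    simpa using h.pow 2

/-- Symmetry of an operator. -/
def IsSymm (T : H →ₗ.[ℂ] H) : Prop :=
  ∀ x y : T.domain, inner ℂ (T x) (y : H) = inner ℂ (x : H) (T y)

theorem inner_adjoint {S : H →ₗ.[ℂ] H} (hd : Dense (S.domain : Set H)) (f : S†.domain)
    (u : S.domain) : inner ℂ (S† f) (u : H) = inner ℂ (f : H) (S u) :=
  LinearPMap.adjoint_isFormalAdjoint hd f u

theorem mem_adjoint_of_inner {S : H →ₗ.[ℂ] H} (hd : Dense (S.domain : Set H)) {f g : H}
    (h : ∀ u : S.domain, inner ℂ g (u : H) = inner ℂ f (S u)) :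
    ∃ hf : f ∈ S†.domain, S† ⟨f, hf⟩ = g :=
  ⟨LinearPMap.mem_adjoint_domain_of_exists _ ⟨g, h⟩, LinearPMap.adjoint_apply_eq hd _ h⟩

/-- The elements of `D(S*)` orthogonal, in the boundary form, to the domain of a symmetric
restriction `W` of `S*` with `S* + I` onto, belong to `W`. -/
theorem mem_of_boundary_orthogonal {S : H →ₗ.[ℂ] H} {W : Submodule ℂ H}
    (hsym : ∀ x y : S†.domain, (x : H) ∈ W → (y : H) ∈ W →
      inner ℂ (S† x) (y : H) = inner ℂ (x : H) (S† y))
    (hsurj : ∀ g : H, ∃ x : S†.domain, (x : H) ∈ W ∧ S† x + x = g)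
    (f : S†.domain) (hf : ∀ x : S†.domain, (x : H) ∈ W →
      inner ℂ (S† f) (x : H) = inner ℂ (f : H) (S† x)) : (f : H) ∈ W := by
  -- By this choice `f - x` lies in `ker (S* + I)`. Moving `S* + I` from `y` onto `f - x` gives `‖f
  -- - x‖² = (f - x, (S* + I) y) = 0`.
  obtain ⟨x, hx, e⟩ := hsurj (S† f + f)
  obtain ⟨y, hy, e'⟩ := hsurj (f - x)
  have h1 := hf y hy
  have h2 := hsym x y hx hy
  have h3 : S† f = S† x + x - f := by rw [e]; abel
  rw [h3, inner_sub_left, inner_add_left, h2] at h1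
  have h4 : inner ℂ ((f : H) - x) ((f : H) - x) = 0 := by
    nth_rw 2 [← e']
    simp only [inner_add_right, inner_sub_left]
    linear_combination -h1
  have : (f : H) = x := sub_eq_zero.1 (inner_self_eq_zero.1 h4)
  rw [this]; exact hx

/-! ### The Friedrichs and Krein-von Neumann extensions -/

section Extensions

variable {S : H →ₗ.[ℂ] H} {hS : IsNonneg S} {K : Type*} [NormedAddCommGroup K]
  [InnerProductSpace ℂ K] [CompleteSpace K] {J : S.domain →ₗ[ℂ] K}

theorem mem_friedrichs_iff (hJ : ∀ x y, inner ℂ (J x) (J y) = inner ℂ (x : H) (S y)) {f : H} :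
    f ∈ (friedrichs S hS).domain ↔ f ∈ S†.domain ∧ ∃ (u : ℕ → S.domain) (a : K),
      Tendsto (fun k => (u k : H)) atTop (𝓝 f) ∧ Tendsto (fun k => J (u k)) atTop (𝓝 a) := by
  constructor
  · rintro ⟨⟨h1, u, h2, h3⟩, -⟩
    obtain ⟨a, ha⟩ := cauchySeq_tendsto_of_complete ((formCauchy_iff_cauchySeq hJ u).1 h3)
    exact ⟨h1, u, a, h2, ha⟩
  · rintro ⟨h1, u, a, h2, ha⟩
    exact ⟨⟨h1, u, h2, (formCauchy_iff_cauchySeq hJ u).2 ha.cauchySeq⟩, h1⟩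

theorem mem_kreinVonNeumann_iff (hJ : ∀ x y, inner ℂ (J x) (J y) = inner ℂ (x : H) (S y)) {f : H} :
    f ∈ (kreinVonNeumann S hS).domain ↔ ∃ (hf : f ∈ S†.domain) (u : ℕ → S.domain) (a : K),
      Tendsto (fun k => S (u k)) atTop (𝓝 (S† ⟨f, hf⟩)) ∧
        Tendsto (fun k => J (u k)) atTop (𝓝 a) := by
  constructor
  · rintro ⟨⟨h1, u, h2, h3⟩, -⟩
    obtain ⟨a, ha⟩ := cauchySeq_tendsto_of_complete ((formCauchy_iff_cauchySeq hJ u).1 h3)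
    exact ⟨h1, u, a, h2, ha⟩
  · rintro ⟨h1, u, a, h2, ha⟩
    exact ⟨⟨h1, u, h2, (formCauchy_iff_cauchySeq hJ u).2 ha.cauchySeq⟩, h1⟩

theorem inner_lim_left {X Y : Type*} [NormedAddCommGroup X] [InnerProductSpace ℂ X]
    [NormedAddCommGroup Y] [InnerProductSpace ℂ Y] {u : ℕ → X} {v : ℕ → Y}
    {x x' : X} {y y' : Y} (hu : Tendsto u atTop (𝓝 x)) (hv : Tendsto v atTop (𝓝 y))
    (h : ∀ k, inner ℂ (u k) x' = inner ℂ (v k) y') : inner ℂ x x' = inner ℂ y y' := by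
  have h1 := hu.inner (𝕜 := ℂ) (tendsto_const_nhds (x := x'))
  have h2 := hv.inner (𝕜 := ℂ) (tendsto_const_nhds (x := y'))
  simp only [h] at h1
  exact tendsto_nhds_unique h1 h2

/-- The limit of `J u_k`, for `u_k → f` in `H`. -/
theorem inner_limit_of_tendsto
    (hJ : ∀ x y, inner ℂ (J x) (J y) = inner ℂ (x : H) (S y)) {f : H} {u : ℕ → S.domain} {a : K}
    (hu : Tendsto (fun k => (u k : H)) atTop (𝓝 f)) (ha : Tendsto (fun k => J (u k)) atTop (𝓝 a))
    (w : S.domain) : inner ℂ a (J w) = inner ℂ f (S w) :=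
  inner_lim_left ha hu fun _ => hJ _ _

/-- The limit of `J u_k`, for `S u_k → S* f` in `H`. -/
theorem inner_limit_of_tendsto_map (hd : Dense (S.domain : Set H)) (hSs : IsSymm S)
    (hJ : ∀ x y, inner ℂ (J x) (J y) = inner ℂ (x : H) (S y)) {f : S†.domain} {u : ℕ → S.domain}
    {a : K} (hu : Tendsto (fun k => S (u k)) atTop (𝓝 (S† f)))
    (ha : Tendsto (fun k => J (u k)) atTop (𝓝 a)) (w : S.domain) :
    inner ℂ a (J w) = inner ℂ (f : H) (S w) := by
  rw [← inner_adjoint hd]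
  exact inner_lim_left ha hu fun k => by rw [hJ, hSs]

/-- With `a`, `b` the limits of the `J`-images attached to `x`, `y`, both sides equal `(a, b)`. -/
theorem friedrichs_symm (hd : Dense (S.domain : Set H))
    (hJ : ∀ x y, inner ℂ (J x) (J y) = inner ℂ (x : H) (S y)) (x y : S†.domain)
    (hx : (x : H) ∈ (friedrichs S hS).domain) (hy : (y : H) ∈ (friedrichs S hS).domain) :
    inner ℂ (S† x) (y : H) = inner ℂ (x : H) (S† y) := by
  obtain ⟨-, u, a, hu, ha⟩ := (mem_friedrichs_iff hJ).1 hx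
  obtain ⟨-, v, b, hv, hb⟩ := (mem_friedrichs_iff hJ).1 hy
  have h1 : inner ℂ (y : H) (S† x) = inner ℂ b a := inner_lim_left hv hb fun k => by
    rw [← inner_conj_symm, inner_adjoint hd, ← inner_limit_of_tendsto hJ hu ha,
      inner_conj_symm]
  have h2 : inner ℂ (x : H) (S† y) = inner ℂ a b := inner_lim_left hu ha fun k => by
    rw [← inner_conj_symm, inner_adjoint hd, ← inner_limit_of_tendsto hJ hv hb,
      inner_conj_symm]
  rw [h2, ← inner_conj_symm, h1, inner_conj_symm]

theorem kreinVonNeumann_symm (hd : Dense (S.domain : Set H)) (hSs : IsSymm S)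
    (hJ : ∀ x y, inner ℂ (J x) (J y) = inner ℂ (x : H) (S y)) (x y : S†.domain)
    (hx : (x : H) ∈ (kreinVonNeumann S hS).domain) (hy : (y : H) ∈ (kreinVonNeumann S hS).domain) :
    inner ℂ (S† x) (y : H) = inner ℂ (x : H) (S† y) := by
  obtain ⟨_, u, a, hu, ha⟩ := (mem_kreinVonNeumann_iff hJ).1 hx
  obtain ⟨_, v, b, hv, hb⟩ := (mem_kreinVonNeumann_iff hJ).1 hy
  have h1 : inner ℂ (S† x) (y : H) = inner ℂ a b := inner_lim_left hu ha fun k => by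
    rw [← inner_conj_symm, ← inner_limit_of_tendsto_map hd hSs hJ hv hb, inner_conj_symm]
  have h2 : inner ℂ (S† y) (x : H) = inner ℂ b a := inner_lim_left hv hb fun k => by
    rw [← inner_conj_symm, ← inner_limit_of_tendsto_map hd hSs hJ hu ha, inner_conj_symm]
  rw [h1, ← inner_conj_symm, ← h2, inner_conj_symm]

/-- Projection onto the closure of `{(J u, u)}` gives `(e, S u) + (e, u) = (g, u)`, that is, `S* e =
g - e`. -/
theorem friedrichs_add_id_surjective (hd : Dense (S.domain : Set H))
    (hJ : ∀ x y, inner ℂ (J x) (J y) = inner ℂ (x : H) (S y)) (g : H) :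
    ∃ x : S†.domain, (x : H) ∈ (friedrichs S hS).domain ∧ S† x + x = g := by
  obtain ⟨v, a, e, ha, he, h⟩ := exists_seq_tendsto_inner_eq J S.domain.subtype g
  obtain ⟨hf, h1⟩ := mem_adjoint_of_inner hd (f := e) (g := g - e) fun u => by
    rw [← inner_limit_of_tendsto hJ he ha, inner_sub_left]
    have h2 : inner ℂ a (J u) + inner ℂ e (u : H) = inner ℂ g (u : H) := h u
    linear_combination -h2
  exact ⟨⟨e, hf⟩, (mem_friedrichs_iff hJ).2 ⟨hf, v, a, he, ha⟩, by rw [h1]; simp⟩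

/-- The Friedrichs argument with `u` and `S u` exchanged: projection onto the closure of `{(J u, S
u)}` gives `(e, u) + (e, S u) = (g, S u)`, so `f = g - e` has `S* f = e`. -/
theorem kreinVonNeumann_add_id_surjective (hd : Dense (S.domain : Set H)) (hSs : IsSymm S)
    (hJ : ∀ x y, inner ℂ (J x) (J y) = inner ℂ (x : H) (S y)) (g : H) :
    ∃ x : S†.domain, (x : H) ∈ (kreinVonNeumann S hS).domain ∧ S† x + x = g := by
  obtain ⟨v, a, e, ha, he, h⟩ := exists_seq_tendsto_inner_eq J S.toFun g
  obtain ⟨hf, h1⟩ := mem_adjoint_of_inner hd (f := g - e) (g := e) fun u => by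
    have h2 : inner ℂ a (J u) = inner ℂ e (u : H) := inner_lim_left ha he fun k => by
      rw [hJ]; exact (hSs _ _).symm
    have h3 : inner ℂ a (J u) + inner ℂ e (S u) = inner ℂ g (S u) := h u
    rw [← h2, inner_sub_left]
    linear_combination h3
  exact ⟨⟨g - e, hf⟩, (mem_kreinVonNeumann_iff hJ).2 ⟨hf, v, a, by rw [h1]; exact he, ha⟩,
    by rw [h1]; simp⟩

/-- The elements of `D(A_F)` and of `D(A_N)` are form-bounded. -/
theorem exists_bound_of_mem_friedrichs
    (hJ : ∀ x y, inner ℂ (J x) (J y) = inner ℂ (x : H) (S y)) {f : H}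
    (hf : f ∈ (friedrichs S hS).domain) :
    ∃ C : ℝ, ∀ u : S.domain, ‖inner ℂ f (S u)‖ ≤ C * ‖J u‖ := by
  obtain ⟨-, u, a, hu, ha⟩ := (mem_friedrichs_iff hJ).1 hf
  exact ⟨‖a‖, fun w => by
    rw [← inner_limit_of_tendsto hJ hu ha]; exact norm_inner_le_norm _ _⟩

theorem exists_bound_of_mem_kreinVonNeumann (hd : Dense (S.domain : Set H)) (hSs : IsSymm S)
    (hJ : ∀ x y, inner ℂ (J x) (J y) = inner ℂ (x : H) (S y)) {f : H}
    (hf : f ∈ (kreinVonNeumann S hS).domain) :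
    ∃ C : ℝ, ∀ u : S.domain, ‖inner ℂ f (S u)‖ ≤ C * ‖J u‖ := by
  obtain ⟨hf', u, a, hu, ha⟩ := (mem_kreinVonNeumann_iff hJ).1 hf
  exact ⟨‖a‖, fun w => by
    have := inner_limit_of_tendsto_map hd hSs hJ hu ha w
    rw [← this]; exact norm_inner_le_norm _ _⟩

/-- An element of `D(A_F) ∩ D(A_N)` is orthogonal in the boundary form to every form-bounded
element of `D(S*)`. -/
theorem boundary_form_eq_of_mem_inf (hd : Dense (S.domain : Set H)) (hSs : IsSymm S)
    (hJ : ∀ x y, inner ℂ (J x) (J y) = inner ℂ (x : H) (S y)) (hJd : DenseRange J)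
    (f g : S†.domain) (hF : (f : H) ∈ (friedrichs S hS).domain)
    (hN : (f : H) ∈ (kreinVonNeumann S hS).domain)
    (hg : ∃ C : ℝ, ∀ u : S.domain, ‖inner ℂ (g : H) (S u)‖ ≤ C * ‖J u‖) :
    inner ℂ (S† g) (f : H) = inner ℂ (g : H) (S† f) := by
  obtain ⟨-, u, a, hu, ha⟩ := (mem_friedrichs_iff hJ).1 hF
  obtain ⟨_, v, b, hv, hb⟩ := (mem_kreinVonNeumann_iff hJ).1 hN
  -- Both limits have the same inner product `(f, S w)` with `J w`, and the range of `J` is dense.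
  have hab : a = b := hJd.eq_of_inner_left ℂ (fun w => by
    rw [inner_limit_of_tendsto hJ hu ha, ← inner_limit_of_tendsto_map hd hSs hJ hv hb])
  obtain ⟨C, hC⟩ := hg
  -- The limit of `(g, S (u_k - v_k))` is computed twice: it is zero by form-boundedness of `g`, and
  -- it is the boundary form of `g` and `f`.
  have h0 : Tendsto (fun k => inner ℂ (g : H) (S (u k - v k))) atTop (𝓝 0) := by
    have h1 : Tendsto (fun k => C * ‖J (u k - v k)‖) atTop (𝓝 0) := by
      have := (ha.sub hb).norm.const_mul C
      simpa [hab] using this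
    exact squeeze_zero_norm (fun k => hC _) h1
  have h1 : Tendsto (fun k => inner ℂ (g : H) (S (u k - v k))) atTop
      (𝓝 (inner ℂ (S† g) (f : H) - inner ℂ (g : H) (S† f))) := by
    refine ((tendsto_const_nhds.inner hu).sub (tendsto_const_nhds.inner hv)).congr fun k => ?_
    rw [LinearPMap.map_sub, inner_sub_right, inner_adjoint hd]
  exact sub_eq_zero.1 (tendsto_nhds_unique h1 h0)

end Extensions

/-- Cauchy-Schwarz for a nonnegative symmetric operator. -/
theorem norm_inner_map_le (T : H →ₗ.[ℂ] H) (hT : IsSymm T) (hn : IsNonneg T) (x y : T.domain) :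
    ‖inner ℂ (x : H) (T y)‖ ≤ √(qform T x) * √(qform T y) := by
  obtain ⟨K, _, _, _, J, -, hJ⟩ := exists_dense_realization T.domain.subtype T.toFun
    (fun x y => hT x y) (fun x => hn x)
  have hJ' : ∀ x y, inner ℂ (J x) (J y) = inner ℂ (x : H) (T y) := hJ
  rw [← hJ', ← norm_sq_eq_qform hJ', ← norm_sq_eq_qform hJ', Real.sqrt_sq (norm_nonneg _),
    Real.sqrt_sq (norm_nonneg _)]
  exact norm_inner_le_norm _ _

/-! ### Resolvent and square root of `A + I` -/

theorem isSymm_of_isSelfAdjoint {T : H →ₗ.[ℂ] H} (hT : IsSelfAdjoint T) : IsSymm T := by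
  have h := LinearPMap.adjoint_isFormalAdjoint (𝕜 := ℂ) hT.dense_domain
  rw [LinearPMap.isSelfAdjoint_def.1 hT] at h
  exact h

theorem mem_domain_of_inner {T : H →ₗ.[ℂ] H} (hT : IsSelfAdjoint T) {f g : H}
    (h : ∀ u : T.domain, inner ℂ g (u : H) = inner ℂ f (T u)) :
    ∃ hf : f ∈ T.domain, T ⟨f, hf⟩ = g := by
  have h1 := mem_adjoint_of_inner hT.dense_domain h
  rwa [LinearPMap.isSelfAdjoint_def.1 hT] at h1

theorem IsSymm.addId {T : H →ₗ.[ℂ] H} (hT : IsSymm T) : IsSymm (addId T) := fun x y => by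
  change inner ℂ ((x : H) + T x) (y : H) = inner ℂ (x : H) ((y : H) + T y)
  rw [inner_add_left, inner_add_right, hT]

theorem norm_le_norm_addId {T : H →ₗ.[ℂ] H} (hn : IsNonneg T) (u : T.domain) :
    ‖(u : H)‖ ≤ ‖addId T u‖ := by
  have h1 : ‖(u : H)‖ ^ 2 ≤ ‖addId T u‖ * ‖(u : H)‖ := by
    refine le_trans ?_ ((Complex.re_le_norm _).trans (norm_inner_le_norm (𝕜 := ℂ) _ _))
    change _ ≤ (inner ℂ ((u : H) + T u) (u : H)).re
    have h2 : (inner ℂ (u : H) (u : H)).re = ‖(u : H)‖ ^ 2 := inner_self_eq_norm_sq (𝕜 := ℂ) _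
    rw [inner_add_left, Complex.add_re, h2]
    linarith [hn u]
  by_contra hlt
  push Not at hlt
  nlinarith [norm_nonneg (addId T u)]

/-- `A + I` maps `D(A)` onto `H`, for a nonnegative self-adjoint operator `A`. -/
theorem addId_surjective {A : H →ₗ.[ℂ] H} (hsa : IsSelfAdjoint A) (hn : IsNonneg A) :
    Function.Surjective (addId A) := by
  let M : Submodule ℂ H := LinearMap.range (addId A).toFun
  -- Preimages of a convergent sequence are Cauchy since `‖u‖ ≤ ‖(A + I) u‖`, and `A` is closed.
  have hcl : IsClosed (M : Set H) := by
    refine isClosed_of_closure_subset fun y hy => ?_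
    obtain ⟨s, hs, hlim⟩ := mem_closure_iff_seq_limit.1 hy
    choose u hu using hs
    have hc : CauchySeq (fun k => ((u k : A.domain) : H)) := by
      have hc' := hlim.cauchySeq
      rw [Metric.cauchySeq_iff] at hc' ⊢
      intro ε hε
      obtain ⟨N, hN⟩ := hc' ε hε
      refine ⟨N, fun m hm k hk => lt_of_le_of_lt ?_ (hN m hm k hk)⟩
      rw [dist_eq_norm, dist_eq_norm, ← hu, ← hu, ← map_sub]
      exact norm_le_norm_addId hn (u m - u k)
    obtain ⟨x, hx⟩ := cauchySeq_tendsto_of_complete hc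
    have hA : Tendsto (fun k => A (u k)) atTop (𝓝 (y - x)) := by
      refine (hlim.sub hx).congr fun k => ?_
      rw [← hu]
      exact add_sub_cancel_left _ _
    have hg : (x, y - x) ∈ A.graph := by
      have hclosed : IsClosed (A.graph : Set (H × H)) := hsa.isClosed
      exact hclosed.mem_of_tendsto (hx.prodMk_nhds hA)
        (Eventually.of_forall fun k => A.mem_graph (u k))
    obtain ⟨x', hx', hy'⟩ := (A.mem_graph_iff).1 hg
    refine ⟨x', ?_⟩
    change (x' : H) + A x' = y
    rw [hy', hx']
    exact add_sub_cancel _ _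
  -- A vector `y` orthogonal to the range satisfies `A y = -y` by self-adjointness, hence is zero.
  have hbot : Mᗮ = ⊥ := by
    rw [Submodule.eq_bot_iff]
    intro y hy
    have h0 : ∀ u : A.domain, inner ℂ (-y) (u : H) = inner ℂ y (A u) := fun u => by
      have h1 : inner ℂ y ((u : H) + A u) = 0 := by
        exact Submodule.inner_left_of_mem_orthogonal (⟨u, rfl⟩ : addId A u ∈ M) hy
      rw [inner_add_right] at h1
      rw [inner_neg_left]
      linear_combination -h1
    obtain ⟨hy', e⟩ := mem_domain_of_inner hsa h0
    have h2 := norm_le_norm_addId hn ⟨y, hy'⟩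
    have h3 : addId A ⟨y, hy'⟩ = 0 := by
      change y + A ⟨y, hy'⟩ = 0
      rw [e, add_neg_cancel]
    rw [h3, norm_zero] at h2
    exact norm_le_zero_iff.1 h2
  have htop : M = ⊤ := by
    rw [← hcl.submodule_topologicalClosure_eq, Submodule.topologicalClosure_eq_top_iff, hbot]
  intro y
  exact (htop ▸ Submodule.mem_top : y ∈ M)

/-- The resolvent `(A + I)⁻¹` of a nonnegative self-adjoint operator. -/
theorem exists_resolvent {A : H →ₗ.[ℂ] H} (hsa : IsSelfAdjoint A) (hn : IsNonneg A) :
    ∃ G : H →L[ℂ] H, (∀ u : A.domain, G (addId A u) = u) ∧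
      ∀ y, ∃ u : A.domain, (u : H) = G y ∧ addId A u = y := by
  have hinj : Function.Injective (addId A).toFun := by
    rw [← LinearMap.ker_eq_bot, LinearMap.ker_eq_bot']
    intro u hu
    have h : ‖(u : H)‖ ≤ ‖addId A u‖ := norm_le_norm_addId hn u
    have h' : addId A u = 0 := hu
    rw [h', norm_zero] at h
    exact Subtype.ext (norm_le_zero_iff.1 h)
  let e := LinearEquiv.ofBijective (addId A).toFun ⟨hinj, addId_surjective hsa hn⟩
  have he : ∀ y, addId A (e.symm y) = y := fun y => e.apply_symm_apply y
  refine ⟨((addId A).domain.subtype ∘ₗ e.symm.toLinearMap).mkContinuous 1 fun y => ?_,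
    fun u => ?_, fun y => ⟨e.symm y, rfl, he y⟩⟩
  · rw [one_mul]
    have := norm_le_norm_addId hn (e.symm y)
    rwa [he] at this
  · exact congrArg Subtype.val (e.symm_apply_apply u)

/-- The root is `Q⁻¹`, where `Q` is the square root of the bounded positive resolvent `G = (A +
I)⁻¹`. Only bounded functional calculus is needed. -/
theorem exists_isNonnegSqrt_addId {A : H →ₗ.[ℂ] H} (hsa : IsSelfAdjoint A) (hn : IsNonneg A) :
    ∃ B, IsNonnegSqrt (addId A) B := by
  obtain ⟨G, hG1, hG2⟩ := exists_resolvent hsa hn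
  have hsymm := (isSymm_of_isSelfAdjoint hsa).addId
  have hGpos : G.IsPositive := by
    constructor
    · intro x y
      obtain ⟨u, hu, rfl⟩ := hG2 x
      obtain ⟨v, hv, rfl⟩ := hG2 y
      change inner ℂ (G _) _ = inner ℂ _ (G _)
      rw [hG1, hG1]
      exact (hsymm u v).symm
    · intro x
      obtain ⟨u, hu, rfl⟩ := hG2 x
      change 0 ≤ (inner ℂ (G (addId A u)) ((u : H) + A u)).re
      rw [hG1, inner_add_right, Complex.add_re, ← isSymm_of_isSelfAdjoint hsa]
      exact add_nonneg (inner_self_nonneg (𝕜 := ℂ)) (hn u)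
  have hG0 : 0 ≤ G := (ContinuousLinearMap.nonneg_iff_isPositive G).2 hGpos
  let Q : H →L[ℂ] H := CFC.sqrt G
  have hQQ : ∀ x, Q (Q x) = G x := fun x => by
    have := CFC.sqrt_mul_sqrt_self G hG0
    exact congrArg (fun F : H →L[ℂ] H => F x) this
  have hQ : Q.IsPositive := (ContinuousLinearMap.nonneg_iff_isPositive _).1 (CFC.sqrt_nonneg G)
  have hQs : ∀ x y, inner ℂ (Q x) y = inner ℂ x (Q y) := fun x y => hQ.isSymmetric x y
  have hGinj : ∀ x, G x = 0 → x = 0 := fun x hx => by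
    obtain ⟨u, hu, rfl⟩ := hG2 x
    rw [hx] at hu
    have : u = 0 := Subtype.ext hu
    rw [this]; exact LinearPMap.map_zero _
  have hQinj : ∀ x, Q x = 0 → x = 0 := fun x hx => hGinj x (by rw [← hQQ, hx, map_zero])
  let P : H →ₗ.[ℂ] H := Q.toLinearMap.toPMap ⊤
  have hker : P.toFun.ker = ⊥ := by
    rw [LinearMap.ker_eq_bot']
    intro x hx
    exact Subtype.ext (hQinj x hx)
  let B := P.inverse
  have hB : ∀ x y, (x, y) ∈ B.graph ↔ Q y = x := fun x y => by
    change (x, y) ∈ P.inverse.graph ↔ _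
    rw [LinearPMap.inverse_graph hker, Submodule.mem_map]
    constructor
    · rintro ⟨p, hp, e⟩
      obtain ⟨z, hz1, hz2⟩ := (P.mem_graph_iff).1 hp
      obtain ⟨rfl, rfl⟩ := Prod.mk.inj e
      rw [← hz2, ← hz1]; rfl
    · rintro rfl
      exact ⟨(y, Q y), (P.mem_graph_iff).2 ⟨⟨y, trivial⟩, rfl, rfl⟩, rfl⟩
  have hBdom : ∀ y, ∃ x : B.domain, (x : H) = Q y ∧ B x = y := fun y =>
    (B.mem_graph_iff).1 ((hB _ _).2 rfl)
  have hBap : ∀ x : B.domain, Q (B x) = x := fun x => (hB _ _).1 (B.mem_graph x)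
  have hBdense : Dense (B.domain : Set H) := by
    have : B.domain.topologicalClosure = ⊤ := by
      rw [Submodule.topologicalClosure_eq_top_iff, Submodule.eq_bot_iff]
      intro y hy
      refine hQinj y (inner_self_eq_zero (𝕜 := ℂ).1 ?_)
      obtain ⟨x, hx, -⟩ := hBdom (Q y)
      rw [hQs, ← hx]
      exact Submodule.inner_left_of_mem_orthogonal x.2 hy
    rw [← Submodule.dense_iff_topologicalClosure_eq_top] at this
    exact this
  refine ⟨B, ?_, ?_, ?_⟩
  · rw [LinearPMap.isSelfAdjoint_def]
    refine le_antisymm ?_ ?_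
    · refine LinearPMap.le_of_le_graph ?_
      rintro ⟨x, y⟩ hxy
      obtain ⟨x', rfl, hy⟩ := (LinearPMap.mem_graph_iff _).1 hxy
      -- Testing `x ∈ D(B*)` against `w = Q v`, for which `B w = v`, gives `Q (B* x) = x`.
      refine (hB _ _).2 (ext_inner_right ℂ fun v => ?_)
      obtain ⟨w, hw, hw'⟩ := hBdom v
      have := inner_adjoint hBdense x' w
      simp only at hy
      rw [hy, hw', hw] at this
      rw [hQs, this]
    · refine LinearPMap.IsFormalAdjoint.le_adjoint hBdense fun x y => ?_
      rw [← hBap y, ← hQs, hBap x]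
  · intro x
    have h1 : 0 ≤ (inner ℂ (B x) (Q (B x))).re := hQ.re_inner_nonneg_right (B x)
    rwa [hBap] at h1
  · intro x y
    constructor
    · intro h
      obtain ⟨u, hu, hy⟩ := (LinearPMap.mem_graph_iff _).1 h
      simp only at hu hy
      refine ⟨Q y, (hB _ _).2 ?_, (hB _ _).2 rfl⟩
      rw [hQQ, ← hy, ← hu, hG1]
    · rintro ⟨z, h1, h2⟩
      rw [hB] at h1 h2
      obtain ⟨u, hu, hy⟩ := hG2 y
      refine (LinearPMap.mem_graph_iff _).2 ⟨u, ?_, hy⟩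
      rw [hu, ← hQQ, h2, h1]

/-- All later arguments use only the `IsNonnegSqrt` properties, so uniqueness of the root plays no
role. -/
theorem isNonnegSqrt_opSqrt_addId {A : H →ₗ.[ℂ] H} (hsa : IsSelfAdjoint A) (hn : IsNonneg A) :
    IsNonnegSqrt (addId A) (opSqrt (addId A)) := by
  have h := exists_isNonnegSqrt_addId hsa hn
  rw [opSqrt, dif_pos h]
  exact h.choose_spec

section Sqrt

variable {T B : H →ₗ.[ℂ] H}

theorem IsNonnegSqrt.mem_domain (h : IsNonnegSqrt T B) (u : T.domain) : (u : H) ∈ B.domain := by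
  obtain ⟨z, hz, -⟩ := (h.2.2 _ _).1 (T.mem_graph u)
  exact LinearPMap.mem_domain_of_mem_graph hz

theorem IsNonnegSqrt.inner_map (h : IsNonnegSqrt T B) (f : B.domain) (u : T.domain) :
    inner ℂ (B f) (B ⟨u, h.mem_domain u⟩) = inner ℂ (f : H) (T u) := by
  obtain ⟨z, hz, hz'⟩ := (h.2.2 _ _).1 (T.mem_graph u)
  obtain ⟨u', hu, rfl⟩ := (B.mem_graph_iff).1 hz
  obtain ⟨v, hv, hv'⟩ := (B.mem_graph_iff).1 hz'
  simp only at hu hv hv'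
  have e : (⟨u, h.mem_domain u⟩ : B.domain) = u' := Subtype.ext hu.symm
  rw [e, ← hv', ← hv]
  exact isSymm_of_isSelfAdjoint h.1 f v

theorem IsNonnegSqrt.surjective (h : IsNonnegSqrt T B) (hT : Function.Surjective T) :
    Function.Surjective B := by
  intro y
  obtain ⟨u, rfl⟩ := hT y
  obtain ⟨z, -, hz'⟩ := (h.2.2 _ _).1 (T.mem_graph u)
  obtain ⟨v, -, hv'⟩ := (B.mem_graph_iff).1 hz'
  exact ⟨v, hv'⟩

/-- Each element of `D(B)` is `B u` with `u ∈ D(T)`. -/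
theorem IsNonnegSqrt.exists_eq_map (h : IsNonnegSqrt T B) (hT : Function.Surjective T)
    (z : B.domain) : ∃ u : T.domain, B ⟨u, h.mem_domain u⟩ = z ∧ T u = B z := by
  obtain ⟨x, hx⟩ := h.surjective hT z
  have : ((x : H), B z) ∈ T.graph :=
    (h.2.2 _ _).2 ⟨z, (B.mem_graph_iff).2 ⟨x, rfl, hx⟩, B.mem_graph z⟩
  obtain ⟨u, hu, hu'⟩ := (T.mem_graph_iff).1 this
  refine ⟨u, ?_, hu'⟩
  have e : (⟨u, h.mem_domain u⟩ : B.domain) = x := Subtype.ext hu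
  rw [e, hx]

/-- A functional `u ↦ (h, T u)` bounded in the norm `‖B u‖` has `h ∈ D(B)`. -/
theorem IsNonnegSqrt.mem_domain_of_bound (h : IsNonnegSqrt T B) (hT : Function.Surjective T)
    {f : H} {C : ℝ}
    (hf : ∀ u : T.domain, ‖inner ℂ f (T u)‖ ≤ C * √(inner ℂ (T u) (u : H)).re) :
    f ∈ B.domain := by
  -- As `B = B*`, it suffices to bound `z ↦ (f, B z)`. Writing `z = B u` with `T u = B z` turns this
  -- into the hypothesis.
  rw [← LinearPMap.isSelfAdjoint_def.1 h.1, LinearPMap.mem_adjoint_domain_iff]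
  refine (LinearMap.mkContinuous _ C fun z => ?_ : B.domain →L[ℂ] ℂ).continuous
  obtain ⟨u, hu, hu'⟩ := h.exists_eq_map hT z
  have h1 := hf u
  have h2 : (inner ℂ (T u) (u : H)).re = ‖(z : H)‖ ^ 2 := by
    rw [← inner_self_eq_norm_sq (𝕜 := ℂ), ← hu, h.inner_map]
    exact inner_re_symm (𝕜 := ℂ) _ _
  rw [h2, Real.sqrt_sq (norm_nonneg _), hu'] at h1
  exact h1

theorem IsNonnegSqrt.bound_of_mem_domain (h : IsNonnegSqrt T B) (f : B.domain) (u : T.domain) :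
    ‖inner ℂ (f : H) (T u)‖ ≤ ‖B f‖ * √(inner ℂ (T u) (u : H)).re := by
  have h2 : (inner ℂ (T u) (u : H)).re = ‖B ⟨u, h.mem_domain u⟩‖ ^ 2 := by
    rw [← inner_self_eq_norm_sq (𝕜 := ℂ), h.inner_map]
    exact inner_re_symm (𝕜 := ℂ) _ _
  rw [h2, Real.sqrt_sq (norm_nonneg _), ← h.inner_map]
  exact norm_inner_le_norm _ _

end Sqrt

/-! ### The defect space and the domain of `A_sym*` -/

variable {A : H →ₗ.[ℂ] H} {n : ℕ} {ψ : Fin n → Module.Dual ℂ A.domain}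

/-- Riesz representation of the bounded functional `φ ∘ (A + I)⁻¹` on `H`. -/
theorem extResolvent_spec (hsa : IsSelfAdjoint A) (hn : IsNonneg A) {φ : Module.Dual ℂ A.domain}
    (hφ : φ ∈ hMinusTwo A) (u : A.domain) : φ u = inner ℂ (extResolvent A φ) (addId A u) := by
  have hex : ∃ h : H, ∀ u : A.domain, φ u = inner ℂ h (addId A u) := by
    obtain ⟨G, hG1, hG2⟩ := exists_resolvent hsa hn
    obtain ⟨C, hC⟩ := hφ
    have hGd : ∀ y, G y ∈ A.domain := fun y => by
      obtain ⟨u, hu, -⟩ := hG2 y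
      rw [← hu]; exact u.2
    let g : H →ₗ[ℂ] ℂ := φ ∘ₗ G.toLinearMap.codRestrict A.domain hGd
    have hg : ∀ u : A.domain, g (addId A u) = φ u := fun u =>
      congrArg φ (Subtype.ext (hG1 u))
    let F : StrongDual ℂ H := g.mkContinuous C fun y => by
      obtain ⟨u, -, rfl⟩ := hG2 y
      rw [hg]; exact hC u
    refine ⟨(InnerProductSpace.toDual ℂ H).symm F, fun u => ?_⟩
    rw [InnerProductSpace.toDual_symm_apply]
    exact (hg u).symm
  rw [extResolvent, dif_pos hex]
  exact hex.choose_spec u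

variable (A ψ) in
/-- `α ↦ ∑ₚ αₚ hₚ`, with values in the defect space `ker (A_sym* + I)`. -/
def defect : (Fin n → ℂ) →ₗ[ℂ] H :=
  Fintype.linearCombination ℂ (fun p => extResolvent A (ψ p))

theorem assemble_eq (p : A.domain × (Fin n → ℂ)) :
    assemble A ψ p = (p.1 : H) + defect A ψ p.2 := rfl

theorem inner_defect (hsa : IsSelfAdjoint A) (hn : IsNonneg A) (hψ : ∀ j, ψ j ∈ hMinusTwo A)
    (α : Fin n → ℂ) (u : A.domain) :
    inner ℂ (defect A ψ α) (addId A u) = ∑ j, (starRingEnd ℂ) (α j) * ψ j u := by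
  rw [defect, Fintype.linearCombination_apply, sum_inner]
  exact Finset.sum_congr rfl fun j _ => by
    rw [inner_smul_left, ← extResolvent_spec hsa hn (hψ j)]

/-- The conjugates appear because `h` represents its functional from the conjugate-linear slot of
the inner product. -/
theorem extResolvent_sum (hsa : IsSelfAdjoint A) (hn : IsNonneg A)
    (hψ : ∀ j, ψ j ∈ hMinusTwo A) (c : Fin n → ℂ) :
    extResolvent A (∑ j, c j • ψ j) = defect A ψ (fun j => (starRingEnd ℂ) (c j)) := by
  refine ext_inner_right ℂ fun y => ?_
  obtain ⟨u, rfl⟩ := addId_surjective hsa hn y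
  rw [← extResolvent_spec hsa hn (Submodule.sum_mem _ fun j _ => Submodule.smul_mem _ _ (hψ j)),
    inner_defect hsa hn hψ]
  simp [LinearMap.sum_apply]

theorem symRestriction_apply (u : (symRestriction A ψ).domain) :
    symRestriction A ψ u = A ⟨u, u.2.2⟩ := LinearPMap.domRestrict_apply rfl

theorem mem_symRestriction_domain_iff (u : A.domain) :
    (u : H) ∈ (symRestriction A ψ).domain ↔ ∀ j, ψ j u = 0 := by
  constructor
  · rintro ⟨⟨v, hv, e⟩, -⟩ j
    obtain rfl : v = u := Subtype.ext e
    exact (Submodule.mem_iInf _).1 hv j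
  · exact fun h => ⟨⟨u, (Submodule.mem_iInf _).2 h, rfl⟩, u.2⟩

theorem symRestriction_isSymm (hsa : IsSelfAdjoint A) : IsSymm (symRestriction A ψ) :=
  fun x y => by
    rw [symRestriction_apply, symRestriction_apply]
    exact isSymm_of_isSelfAdjoint hsa ⟨x, x.2.2⟩ ⟨y, y.2.2⟩

/-- The orthogonal complement of the range of `A_sym + I` is spanned by the `h_j`. -/
theorem exists_eq_defect (hsa : IsSelfAdjoint A) (hn : IsNonneg A) (hψ : ∀ j, ψ j ∈ hMinusTwo A)
    {x : H} (hx : ∀ u : A.domain, (∀ j, ψ j u = 0) → inner ℂ x (addId A u) = 0) :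
    ∃ α, x = defect A ψ α := by
  let N := LinearMap.range (defect A ψ)
  -- If `y = (A + I) u` is orthogonal to every `h_j`, then `<ψ_j, u> = 0` for all `j`. The space `N`
  -- is finite-dimensional, hence equals its double complement.
  have h1 : x ∈ Nᗮᗮ := by
    rw [Submodule.mem_orthogonal']
    intro y hy
    obtain ⟨u, rfl⟩ := addId_surjective hsa hn y
    refine hx u fun j => ?_
    have h2 := Submodule.inner_right_of_mem_orthogonal (𝕜 := ℂ)
      (⟨Pi.single j 1, rfl⟩ : defect A ψ (Pi.single j 1) ∈ N) hy
    rw [inner_defect hsa hn hψ] at h2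
    simpa [Pi.single_apply, apply_ite (starRingEnd ℂ)] using h2
  rw [Submodule.orthogonal_orthogonal] at h1
  obtain ⟨α, hα⟩ := h1
  exact ⟨α, hα.symm⟩

/-- If `y = (A + I) x` is orthogonal to `D(A_sym)`, then `x` is a combination of the `h_j`. The
matching combination of the `ψ_j` is represented by `y ∈ H`, so it vanishes, and `x` is orthogonal
to the range of `A + I`. -/
theorem symRestriction_dense (hsa : IsSelfAdjoint A) (hn : IsNonneg A)
    (hψ : ∀ j, ψ j ∈ hMinusTwo A)
    (hind : Submodule.span ℂ (Set.range ψ) ⊓ hZero A = ⊥) :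
    Dense ((symRestriction A ψ).domain : Set H) := by
  rw [Submodule.dense_iff_topologicalClosure_eq_top, Submodule.topologicalClosure_eq_top_iff,
    Submodule.eq_bot_iff]
  intro y hy
  obtain ⟨x, rfl⟩ := addId_surjective hsa hn y
  have hs := (isSymm_of_isSelfAdjoint hsa).addId
  obtain ⟨α, hα⟩ := exists_eq_defect hsa hn hψ (x := (x : H)) fun u hu => by
    rw [← hs x u]
    exact Submodule.inner_left_of_mem_orthogonal ((mem_symRestriction_domain_iff u).2 hu) hy
  have h0 : (∑ j, (starRingEnd ℂ) (α j) • ψ j) ∈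
      Submodule.span ℂ (Set.range ψ) ⊓ hZero A := by
    refine ⟨Submodule.sum_mem _ fun j _ => Submodule.smul_mem _ _ (Submodule.subset_span ⟨j, rfl⟩),
      addId A x, fun u => ?_⟩
    rw [hs x u, hα, inner_defect hsa hn hψ]
    simp [LinearMap.sum_apply]
  rw [hind, Submodule.mem_bot] at h0
  have h1 : ∀ u : A.domain, inner ℂ (x : H) (addId A u) = 0 := fun u => by
    rw [hα, inner_defect hsa hn hψ]
    have := congrArg (fun F : Module.Dual ℂ A.domain => F u) h0
    simpa [LinearMap.sum_apply] using this
  have h2 : x = 0 := by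
    obtain ⟨u, hu⟩ := addId_surjective hsa hn (x : H)
    have := h1 u
    rw [hu] at this
    exact Subtype.ext (inner_self_eq_zero.1 this)
  rw [h2]; exact LinearPMap.map_zero _

/-- The `h_p` lie in `ker (A_sym* + I)`, since `(h_p, (A_sym + I) u) = <ψ_p, u> = 0` on `D(A_sym)`.
-/
theorem assemble_mem_adjoint (hsa : IsSelfAdjoint A) (hn : IsNonneg A)
    (hψ : ∀ j, ψ j ∈ hMinusTwo A) (hd : Dense ((symRestriction A ψ).domain : Set H))
    (p : A.domain × (Fin n → ℂ)) :
    ∃ hf : assemble A ψ p ∈ (symRestriction A ψ)†.domain,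
      (symRestriction A ψ)† ⟨_, hf⟩ = addId A p.1 - assemble A ψ p := by
  refine mem_adjoint_of_inner hd fun u => ?_
  let v : A.domain := ⟨u, u.2.2⟩
  have hv : ∀ j, ψ j v = 0 := (mem_symRestriction_domain_iff v).1 u.2
  have h1 := inner_defect hsa hn hψ p.2 v
  simp only [hv, mul_zero, Finset.sum_const_zero] at h1
  have h2 := (isSymm_of_isSelfAdjoint hsa).addId p.1 v
  have h3 : addId A v = (u : H) + symRestriction A ψ u := by rw [symRestriction_apply]; rfl
  rw [h3] at h1 h2
  have h4 : inner ℂ (addId A p.1) (u : H) = _ := h2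
  rw [inner_sub_left, h4, assemble_eq, inner_add_left, inner_add_left]
  rw [inner_add_right] at h1 ⊢
  linear_combination -h1

/-- Solving `(A + I) u = (A_sym* + I) f` leaves `f - u` orthogonal to the range of `A_sym + I`. -/
theorem exists_eq_assemble (hsa : IsSelfAdjoint A) (hn : IsNonneg A)
    (hψ : ∀ j, ψ j ∈ hMinusTwo A) (hd : Dense ((symRestriction A ψ).domain : Set H))
    (f : (symRestriction A ψ)†.domain) : ∃ p, (f : H) = assemble A ψ p := by
  obtain ⟨u, hu⟩ := addId_surjective hsa hn ((symRestriction A ψ)† f + f)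
  obtain ⟨α, hα⟩ := exists_eq_defect hsa hn hψ (x := (f : H) - u) fun v hv => by
    let w : (symRestriction A ψ).domain := ⟨v, (mem_symRestriction_domain_iff v).2 hv⟩
    have h1 := inner_adjoint hd f w
    have h2 := (isSymm_of_isSelfAdjoint hsa).addId u v
    have h3 : addId A v = (v : H) + symRestriction A ψ w := by rw [symRestriction_apply]; rfl
    rw [inner_sub_left, ← h2, hu, h3, inner_add_left, inner_add_right, h1]
    change _ - (_ + inner ℂ (f : H) (v : H)) = 0
    ring
  exact ⟨(u, α), by rw [assemble_eq, ← hα]; exact (add_sub_cancel _ _).symm⟩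

/-- A functional on `ℂⁿ` that annihilates the image is a linear relation among the `φ_j`. -/
theorem surjective_pi_of_linearIndependent {V : Type*} [AddCommGroup V] [Module ℂ V]
    {φ : Fin n → Module.Dual ℂ V} (hli : LinearIndependent ℂ φ) :
    Function.Surjective (LinearMap.pi φ) := by
  rw [← LinearMap.dualMap_injective_iff, injective_iff_map_eq_zero]
  intro F hF
  have hc : ∀ x, F x = ∑ j, F (Pi.single j 1) * x j := fun x => by
    conv_lhs => rw [pi_eq_sum_univ' x]
    simp [map_sum, mul_comm, Pi.single]
  have h1 : ∑ j, F (Pi.single j 1) • φ j = 0 := by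
    ext u
    have h2 := congrArg (fun T : Module.Dual ℂ V => T u) hF
    simp only [LinearMap.dualMap_apply, hc (LinearMap.pi φ u), LinearMap.zero_apply,
      LinearMap.pi_apply] at h2
    simpa [LinearMap.sum_apply] using h2
  have h3 := Fintype.linearIndependent_iff.1 hli _ h1
  ext x
  simp [h3]

/-- The boundary form of `A_sym*` in terms of `(<ψ_j, u>, α_j)`. -/
theorem boundary_form (hsa : IsSelfAdjoint A) (hn : IsNonneg A)
    (hψ : ∀ j, ψ j ∈ hMinusTwo A) (hd : Dense ((symRestriction A ψ).domain : Set H))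
    {f g : (symRestriction A ψ)†.domain} {p q : A.domain × (Fin n → ℂ)}
    (hf : (f : H) = assemble A ψ p) (hg : (g : H) = assemble A ψ q) :
    inner ℂ ((symRestriction A ψ)† f) (g : H) - inner ℂ (f : H) ((symRestriction A ψ)† g) =
      ∑ j, ((starRingEnd ℂ) (ψ j p.1) * q.2 j - (starRingEnd ℂ) (p.2 j) * ψ j q.1) := by
  have e : ∀ {f : (symRestriction A ψ)†.domain} {p : A.domain × (Fin n → ℂ)},
      (f : H) = assemble A ψ p → (symRestriction A ψ)† f = addId A p.1 - f := fun {f p} h => by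
    obtain ⟨h1, h2⟩ := assemble_mem_adjoint hsa hn hψ hd p
    obtain rfl : f = ⟨_, h1⟩ := Subtype.ext h
    exact h2
  have h1 := inner_defect hsa hn hψ q.2 p.1
  have h2 := inner_defect hsa hn hψ p.2 q.1
  have h3 := (isSymm_of_isSelfAdjoint hsa).addId p.1 q.1
  rw [← inner_conj_symm, ← Complex.conj_conj (∑ j, _ * _)] at h1
  have h4 := (starRingEnd ℂ).injective h1
  rw [e hf, e hg, inner_sub_left, inner_sub_right, Finset.sum_sub_distrib, ← h2]
  have h5 : inner ℂ (addId A p.1) (g : H) =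
      inner ℂ (addId A p.1) (q.1 : H) + inner ℂ (addId A p.1) (defect A ψ q.2) := by
    rw [hg, assemble_eq, inner_add_right]
  have h6 : inner ℂ (f : H) (addId A q.1) =
      inner ℂ (p.1 : H) (addId A q.1) + inner ℂ (defect A ψ p.2) (addId A q.1) := by
    rw [hf, assemble_eq, inner_add_left]
  have h7 : inner ℂ (addId A p.1) (defect A ψ q.2) =
      ∑ j, (starRingEnd ℂ) (ψ j p.1) * q.2 j := by
    rw [h4, map_sum]
    exact Finset.sum_congr rfl fun j _ => by rw [map_mul, Complex.conj_conj, mul_comm]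
  rw [h5, h6, h3, h7]
  ring

/-! ### Transversality and form-boundedness -/

theorem extFunctionals_apply (R : Matrix (Fin n) (Fin n) ℂ) (p : A.domain × (Fin n → ℂ))
    (j : Fin n) : extFunctionals A ψ R p j = ψ j p.1 + R.mulVec p.2 j := rfl

theorem mem_ker_extFunctionals_iff (R : Matrix (Fin n) (Fin n) ℂ) (p : A.domain × (Fin n → ℂ)) :
    p ∈ LinearMap.ker (extFunctionals A ψ R) ↔ ∀ j, ψ j p.1 = -R.mulVec p.2 j := by
  rw [LinearMap.mem_ker, funext_iff]
  exact forall_congr' fun j => by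
    rw [extFunctionals_apply, Pi.zero_apply, add_eq_zero_iff_eq_neg]

/-- A subspace of `D(A_sym*)` that contains `D(A_sym)` and has trivial orthogonal complement in
the boundary form is all of `D(A_sym*)`. -/
theorem eq_adjoint_domain_of_boundary (hsa : IsSelfAdjoint A) (hn : IsNonneg A)
    (hψ : ∀ j, ψ j ∈ hMinusTwo A) (hli : LinearIndependent ℂ ψ)
    (hd : Dense ((symRestriction A ψ).domain : Set H)) {W : Submodule ℂ H}
    (hW : W ≤ (symRestriction A ψ)†.domain) (hSW : (symRestriction A ψ).domain ≤ W)
    (h : ∀ f : (symRestriction A ψ)†.domain,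
      (∀ g : (symRestriction A ψ)†.domain, (g : H) ∈ W →
        inner ℂ ((symRestriction A ψ)† f) (g : H) = inner ℂ (f : H) ((symRestriction A ψ)† g)) →
      ∀ g : (symRestriction A ψ)†.domain,
        inner ℂ ((symRestriction A ψ)† f) (g : H) = inner ℂ (f : H) ((symRestriction A ψ)† g)) :
    W = (symRestriction A ψ)†.domain := by
  let Γ : A.domain × (Fin n → ℂ) →ₗ[ℂ] (Fin n → ℂ) × (Fin n → ℂ) :=
    (LinearMap.pi ψ).prodMap LinearMap.id
  have hΓ : Function.Surjective Γ :=
    (surjective_pi_of_linearIndependent hli).prodMap Function.surjective_id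
  have htop : (W.comap (assemble A ψ)).map Γ = ⊤ := by
    by_contra hne
    obtain ⟨F, hF0, hF⟩ := Submodule.exists_le_ker_of_lt_top _ (lt_top_iff_ne_top.2 hne)
    have hFc : ∀ x : (Fin n → ℂ) × (Fin n → ℂ),
        F x = ∑ j, (F (0, Pi.single j 1) * x.2 j + F (Pi.single j 1, 0) * x.1 j) := fun x => by
      have h1 : ∀ y : Fin n → ℂ, y = ∑ j, y j • (Pi.single j 1 : Fin n → ℂ) := fun y => by
        ext i
        simp [Finset.sum_apply, Pi.single_apply]
      have h2 : F x = F (LinearMap.inl ℂ _ _ x.1) + F (LinearMap.inr ℂ _ _ x.2) := by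
        rw [← map_add]; simp
      rw [h2]
      conv_lhs => rw [h1 x.1, h1 x.2]
      simp only [map_sum, map_smul, LinearMap.inl_apply, LinearMap.inr_apply, smul_eq_mul]
      rw [Finset.sum_add_distrib, add_comm]
      congr 1 <;> exact Finset.sum_congr rfl fun j _ => mul_comm _ _
    -- The boundary values of `p` are chosen so that `F ∘ Γ` is the boundary form with `assemble A ψ
    -- p`. This element is then orthogonal to `W`, which forces `F = 0`.
    obtain ⟨p, hp⟩ := hΓ (fun j => (starRingEnd ℂ) (F (0, Pi.single j 1)),
      fun j => -(starRingEnd ℂ) (F (Pi.single j 1, 0)))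
    have hp1 : ∀ j, ψ j p.1 = (starRingEnd ℂ) (F (0, Pi.single j 1)) := fun j =>
      congrFun (congrArg Prod.fst hp) j
    have hp2 : ∀ j, p.2 j = -(starRingEnd ℂ) (F (Pi.single j 1, 0)) := fun j =>
      congrFun (congrArg Prod.snd hp) j
    obtain ⟨hpd, -⟩ := assemble_mem_adjoint hsa hn hψ hd p
    have hbf : ∀ (g : (symRestriction A ψ)†.domain) (q : A.domain × (Fin n → ℂ)),
        (g : H) = assemble A ψ q →
        inner ℂ ((symRestriction A ψ)† ⟨_, hpd⟩) (g : H) -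
          inner ℂ (assemble A ψ p) ((symRestriction A ψ)† g) = F (Γ q) := fun g q hg => by
      rw [boundary_form hsa hn hψ hd (f := ⟨_, hpd⟩) (p := p) rfl hg, hFc]
      refine Finset.sum_congr rfl fun j _ => ?_
      rw [hp1, hp2, map_neg, Complex.conj_conj, Complex.conj_conj, neg_mul, sub_neg_eq_add]
      rfl
    refine hF0 (LinearMap.ext fun x => ?_)
    obtain ⟨q, rfl⟩ := hΓ x
    obtain ⟨hq, -⟩ := assemble_mem_adjoint hsa hn hψ hd q
    rw [← hbf ⟨_, hq⟩ q rfl, LinearMap.zero_apply, sub_eq_zero]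
    refine h ⟨_, hpd⟩ (fun g hg => ?_) _
    obtain ⟨r, hr⟩ := exists_eq_assemble hsa hn hψ hd g
    rw [← sub_eq_zero]
    refine (hbf g r hr).trans (hF ⟨r, ?_, rfl⟩)
    change assemble A ψ r ∈ W
    rw [← hr]; exact hg
  refine le_antisymm hW fun f hf => ?_
  obtain ⟨p, hp⟩ := exists_eq_assemble hsa hn hψ hd ⟨f, hf⟩
  -- Pairs with equal image under `Γ` assemble to elements that differ by an element of `D(A_sym)`,
  -- hence of `W`.
  obtain ⟨q, hq, e⟩ : Γ p ∈ (W.comap (assemble A ψ)).map Γ := htop ▸ Submodule.mem_top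
  have h1 : (((p.1 - q.1 : A.domain)) : H) ∈ W := hSW ((mem_symRestriction_domain_iff _).2
    fun j => by
      have := congrFun (congrArg Prod.fst e) j
      rw [map_sub, sub_eq_zero]; exact this.symm)
  have h2 : (Γ q).2 = (Γ p).2 := congrArg Prod.snd e
  change q.2 = p.2 at h2
  have h3 : f = ((p.1 - q.1 : A.domain) : H) + assemble A ψ q := by
    have : f = assemble A ψ p := hp
    rw [this, assemble_eq, assemble_eq, h2, Submodule.coe_sub]
    abel
  rw [h3]
  exact W.add_mem h1 hq

theorem matrixOperator_apply {R : Matrix (Fin n) (Fin n) ℂ} (f : (matrixOperator A ψ R).domain) :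
    matrixOperator A ψ R f = (symRestriction A ψ)† ⟨f, f.2.2⟩ :=
  LinearPMap.domRestrict_apply rfl

/-- On the kernel `<ψ_j, u> = -(R α)_j`, so the boundary form is the difference of `(α, R β)` and
`(R α, β)`. -/
theorem matrixOperator_isSymm (hsa : IsSelfAdjoint A) (hn : IsNonneg A)
    (hψ : ∀ j, ψ j ∈ hMinusTwo A) (hd : Dense ((symRestriction A ψ).domain : Set H))
    {R : Matrix (Fin n) (Fin n) ℂ} (hR : R.IsHermitian) : IsSymm (matrixOperator A ψ R) := by
  intro f g
  obtain ⟨p, hp, hfp⟩ := f.2.1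
  obtain ⟨q, hq, hgq⟩ := g.2.1
  have hp' := (mem_ker_extFunctionals_iff R p).1 hp
  have hq' := (mem_ker_extFunctionals_iff R q).1 hq
  rw [matrixOperator_apply, matrixOperator_apply, ← sub_eq_zero]
  refine (boundary_form hsa hn hψ hd (f := ⟨f, f.2.2⟩) (g := ⟨g, g.2.2⟩) hfp.symm hgq.symm).trans ?_
  have h1 : star (R.mulVec p.2) ⬝ᵥ q.2 = star p.2 ⬝ᵥ R.mulVec q.2 := by
    rw [Matrix.star_mulVec, hR.eq, Matrix.dotProduct_mulVec]
  rw [dotProduct, dotProduct] at h1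
  rw [Finset.sum_sub_distrib, sub_eq_zero]
  simp only [hp', hq', map_neg, neg_mul, mul_neg, Finset.sum_neg_distrib, neg_inj]
  exact h1

/-- The domain of a nonnegative symmetric extension consists of form-bounded elements. -/
theorem exists_bound_of_mem_extension {S T : H →ₗ.[ℂ] H} (hST : S ≤ T) (hTs : IsSymm T)
    (hTn : IsNonneg T) {K : Type*} [NormedAddCommGroup K] [InnerProductSpace ℂ K]
    {J : S.domain →ₗ[ℂ] K} (hJ : ∀ x y, inner ℂ (J x) (J y) = inner ℂ (x : H) (S y)) {f : H}
    (hf : f ∈ T.domain) : ∃ C : ℝ, ∀ u : S.domain, ‖inner ℂ f (S u)‖ ≤ C * ‖J u‖ := by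
  -- The constant comes from Cauchy-Schwarz for the form of `T`, which agrees on `D(S)` with that of
  -- `S`.
  refine ⟨√(qform T ⟨f, hf⟩), fun u => ?_⟩
  have e : T ⟨u, hST.1 u.2⟩ = S u := (hST.2 (x := u) rfl).symm
  have h1 := norm_inner_map_le T hTs hTn ⟨f, hf⟩ ⟨u, hST.1 u.2⟩
  have h2 : qform T ⟨u, hST.1 u.2⟩ = ‖J u‖ ^ 2 := by
    rw [norm_sq_eq_qform hJ, qform, qform, e]
  rwa [h2, Real.sqrt_sq (norm_nonneg _), e] at h1

theorem symRestriction_le_adjoint (hsa : IsSelfAdjoint A)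
    (hd : Dense ((symRestriction A ψ).domain : Set H)) :
    symRestriction A ψ ≤ (symRestriction A ψ)† :=
  LinearPMap.IsFormalAdjoint.le_adjoint hd fun x y => symRestriction_isSymm hsa x y

theorem symRestriction_le_matrixOperator (hsa : IsSelfAdjoint A)
    (hd : Dense ((symRestriction A ψ).domain : Set H)) (R : Matrix (Fin n) (Fin n) ℂ) :
    symRestriction A ψ ≤ matrixOperator A ψ R := by
  have hle := symRestriction_le_adjoint hsa hd
  refine ⟨fun u hu => ⟨⟨(⟨u, hu.2⟩, 0), ?_, ?_⟩, hle.1 hu⟩, fun u v huv => ?_⟩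
  · refine (mem_ker_extFunctionals_iff R _).2 fun j => ?_
    rw [(mem_symRestriction_domain_iff ⟨u, hu.2⟩).1 hu j]
    simp
  · simp [assemble_eq]
  · rw [matrixOperator_apply]
    exact hle.2 huv

theorem le_friedrichs_domain {S : H →ₗ.[ℂ] H} {hS : IsNonneg S} (hle : S ≤ S†) :
    S.domain ≤ (friedrichs S hS).domain := fun u hu =>
  ⟨⟨hle.1 hu, fun _ => ⟨u, hu⟩, tendsto_const_nhds, by simpa [FormCauchy] using
    (FormCauchy.zero (S := S))⟩, hle.1 hu⟩

/-- If every element of `D(A_sym*)` is form-bounded, then `A_F` and `A_N` are transversal. -/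
theorem transversal_of_bound (hsa : IsSelfAdjoint A) (hn : IsNonneg A)
    (hψ : ∀ j, ψ j ∈ hMinusTwo A) (hli : LinearIndependent ℂ ψ)
    (hd : Dense ((symRestriction A ψ).domain : Set H)) {K : Type*} [NormedAddCommGroup K]
    [InnerProductSpace ℂ K] [CompleteSpace K] {J : (symRestriction A ψ).domain →ₗ[ℂ] K}
    (hJ : ∀ x y, inner ℂ (J x) (J y) = inner ℂ (x : H) (symRestriction A ψ y))
    (hJd : DenseRange J) (hS : IsNonneg (symRestriction A ψ))
    (hb : ∀ f ∈ (symRestriction A ψ)†.domain, ∃ C : ℝ, ∀ u : (symRestriction A ψ).domain,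
      ‖inner ℂ f (symRestriction A ψ u)‖ ≤ C * ‖J u‖) :
    Transversal (symRestriction A ψ) (friedrichs _ hS) (kreinVonNeumann _ hS) := by
  have hSs := symRestriction_isSymm (ψ := ψ) hsa
  have hF : (friedrichs _ hS).domain ≤ (symRestriction A ψ)†.domain := inf_le_right
  have hN : (kreinVonNeumann _ hS).domain ≤ (symRestriction A ψ)†.domain := inf_le_right
  refine eq_adjoint_domain_of_boundary hsa hn hψ hli hd (sup_le hF hN)
    ((le_friedrichs_domain (symRestriction_le_adjoint hsa hd)).trans le_sup_left)
    fun f hf g => ?_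
  -- Orthogonality to each summand places `f` in both domains.
  have h1 := mem_of_boundary_orthogonal (friedrichs_symm (hS := hS) hd hJ)
    (friedrichs_add_id_surjective hd hJ) f fun x hx => hf x (Submodule.mem_sup_left hx)
  have h2 := mem_of_boundary_orthogonal (kreinVonNeumann_symm (hS := hS) hd hSs hJ)
    (kreinVonNeumann_add_id_surjective hd hSs hJ) f fun x hx => hf x (Submodule.mem_sup_right hx)
  have h3 := boundary_form_eq_of_mem_inf hd hSs hJ hJd f g h1 h2 (hb g g.2)
  rw [← inner_conj_symm, ← h3, inner_conj_symm]

/-- `D(A_sym*)` is the sum of `D(A₀)` and of the domain of `Ã`. -/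
theorem exists_add_of_mem_adjoint (hsa : IsSelfAdjoint A) (hn : IsNonneg A)
    (hψ : ∀ j, ψ j ∈ hMinusTwo A) (hli : LinearIndependent ℂ ψ)
    (hd : Dense ((symRestriction A ψ).domain : Set H)) (R : Matrix (Fin n) (Fin n) ℂ) {f : H}
    (hf : f ∈ (symRestriction A ψ)†.domain) :
    ∃ x ∈ A.domain, ∃ y ∈ (matrixOperator A ψ R).domain, f = x + y := by
  obtain ⟨p, hp⟩ := exists_eq_assemble hsa hn hψ hd ⟨f, hf⟩
  -- Keeping the coefficients `α` and taking `u` with `<ψ_j, u> = -(R α)_j` gives an element of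
  -- `D(Ã)` that differs from `f` by one of `D(A₀)`.
  obtain ⟨u, hu⟩ := surjective_pi_of_linearIndependent hli (-R.mulVec p.2)
  refine ⟨(p.1 - u : A.domain), (p.1 - u).2, assemble A ψ (u, p.2),
    ⟨⟨(u, p.2), (mem_ker_extFunctionals_iff R _).2 fun j => congrFun hu j, rfl⟩,
      (assemble_mem_adjoint hsa hn hψ hd _).1⟩, ?_⟩
  have h1 : f = assemble A ψ p := hp
  rw [h1, assemble_eq, assemble_eq, Submodule.coe_sub]
  abel

theorem transversal_of_isNonneg (hsa : IsSelfAdjoint A) (hn : IsNonneg A)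
    (hψ : ∀ j, ψ j ∈ hMinusTwo A) (hli : LinearIndependent ℂ ψ)
    (hd : Dense ((symRestriction A ψ).domain : Set H)) (hS : IsNonneg (symRestriction A ψ))
    {R : Matrix (Fin n) (Fin n) ℂ} (hR : R.IsHermitian) (hRn : IsNonneg (matrixOperator A ψ R)) :
    Transversal (symRestriction A ψ) (friedrichs _ hS) (kreinVonNeumann _ hS) := by
  obtain ⟨K, _, _, _, J, hJd, hJ⟩ := exists_dense_realization (symRestriction A ψ).domain.subtype
    (symRestriction A ψ).toFun (symRestriction_isSymm hsa) (fun x => hS x)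
  refine transversal_of_bound (J := J) hsa hn hψ hli hd hJ hJd hS fun f hf => ?_
  obtain ⟨x, hx, y, hy, rfl⟩ := exists_add_of_mem_adjoint hsa hn hψ hli hd R hf
  obtain ⟨C, hC⟩ := exists_bound_of_mem_extension (S := symRestriction A ψ) (J := J)
    LinearPMap.domRestrict_le (isSymm_of_isSelfAdjoint hsa) hn hJ hx
  obtain ⟨C', hC'⟩ := exists_bound_of_mem_extension (J := J)
    (symRestriction_le_matrixOperator hsa hd R) (matrixOperator_isSymm hsa hn hψ hd hR) hRn hJ hy
  refine ⟨C + C', fun u => ?_⟩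
  rw [inner_add_left, add_mul]
  exact (norm_add_le _ _).trans (add_le_add (hC u) (hC' u))

/-- If `A_F` and `A_N` are transversal, then every element of `D(A_sym*)` is form-bounded. -/
theorem exists_bound_of_transversal {S : H →ₗ.[ℂ] H} (hd : Dense (S.domain : Set H))
    (hSs : IsSymm S) (hS : IsNonneg S)
    (h : Transversal S (friedrichs S hS) (kreinVonNeumann S hS)) {f : H} (hf : f ∈ S†.domain) :
    ∃ C : ℝ, 0 ≤ C ∧ ∀ u : S.domain, ‖inner ℂ f (S u)‖ ≤ C * √(qform S u) := by
  obtain ⟨K, _, _, _, J, -, hJ'⟩ := exists_dense_realization S.domain.subtype S.toFun hSs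
    (fun x => hS x)
  have hJ : ∀ x y, inner ℂ (J x) (J y) = inner ℂ (x : H) (S y) := hJ'
  rw [← h] at hf
  obtain ⟨x, hx, y, hy, rfl⟩ := Submodule.mem_sup.1 hf
  obtain ⟨C, hC⟩ := exists_bound_of_mem_friedrichs hJ hx
  obtain ⟨C', hC'⟩ := exists_bound_of_mem_kreinVonNeumann hd hSs hJ hy
  refine ⟨|C + C'|, abs_nonneg _, fun u => ?_⟩
  rw [← norm_sq_eq_qform hJ, Real.sqrt_sq (norm_nonneg _)]
  refine le_trans ?_ (mul_le_mul_of_nonneg_right (le_abs_self _) (norm_nonneg _))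
  rw [inner_add_left, add_mul]
  exact (norm_add_le _ _).trans (add_le_add (hC u) (hC' u))

/-! ### Construction of a nonnegative admissible operator -/

section Gram

variable {E : Type*} [NormedAddCommGroup E] [InnerProductSpace ℂ E]

theorem sum_gram_mulVec (Y : (Fin n → ℂ) →ₗ[ℂ] E) (δ α : Fin n → ℂ) :
    ∑ j, (starRingEnd ℂ) (δ j) *
      (Matrix.gram ℂ fun i => Y (Pi.single i 1)).mulVec α j = inner ℂ (Y δ) (Y α) := by
  have h1 : ∀ y : Fin n → ℂ, Y y = ∑ j, y j • Y (Pi.single j 1) := fun y => by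
    have h2 : y = ∑ j, y j • (Pi.single j 1 : Fin n → ℂ) := by
      ext i
      simp [Finset.sum_apply, Pi.single_apply]
    conv_lhs => rw [h2]
    simp only [map_sum, map_smul]
  rw [h1 δ, h1 α, sum_inner]
  refine Finset.sum_congr rfl fun j _ => ?_
  rw [inner_smul_left, inner_sum, Matrix.mulVec, dotProduct]
  congr 1
  refine Finset.sum_congr rfl fun p _ => ?_
  rw [inner_smul_right, Matrix.gram_apply, mul_comm]

end Gram

theorem norm_sqrt_sq {T B : H →ₗ.[ℂ] H} (hB : IsNonnegSqrt (addId T) B) (u : T.domain) :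
    ‖B ⟨u, hB.mem_domain u⟩‖ ^ 2 = ‖(u : H)‖ ^ 2 + qform T u := by
  rw [← inner_self_eq_norm_sq (𝕜 := ℂ), hB.inner_map, ← inner_self_eq_norm_sq (𝕜 := ℂ) (u : H)]
  change (inner ℂ (u : H) ((u : H) + T u)).re = _
  rw [inner_add_right, Complex.add_re, qform]
  congr 1
  exact inner_re_symm (𝕜 := ℂ) _ _

/-- Write `x = B u` with `(A + I) u = B x`. Then `‖u‖ ≤ ‖x‖` and `‖x‖² = (u, B x) ≤ ‖x‖ ‖B x‖`. -/
theorem norm_le_norm_sqrt (hsa : IsSelfAdjoint A) (hn : IsNonneg A) {B : H →ₗ.[ℂ] H}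
    (hB : IsNonnegSqrt (addId A) B) (x : B.domain) : ‖(x : H)‖ ≤ ‖B x‖ := by
  obtain ⟨u, hu, hu'⟩ := hB.exists_eq_map (addId_surjective hsa hn) x
  have h1 := norm_sqrt_sq hB u
  have h2 : ‖(u : H)‖ ≤ ‖(x : H)‖ := by
    rw [hu] at h1
    have h3 : 0 ≤ qform A u := hn u
    exact (sq_le_sq₀ (norm_nonneg _) (norm_nonneg _)).1 (by rw [h1]; linarith)
  have h3 := hB.bound_of_mem_domain ⟨u, hB.mem_domain u⟩ u
  have h4 : ‖(x : H)‖ ^ 2 ≤ ‖(x : H)‖ * ‖B x‖ := by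
    rw [← hu, ← inner_self_eq_norm_sq (𝕜 := ℂ), hB.inner_map, hu', hu]
    exact (Complex.re_le_norm _).trans ((norm_inner_le_norm _ _).trans
      (mul_le_mul_of_nonneg_right h2 (norm_nonneg _)))
  by_contra hlt
  push Not at hlt
  nlinarith [norm_nonneg (B x)]

/-- `D(A_sym)` is dense, in the norm of the energy space, in the orthogonal complement of the part
of the defect space that lies in the energy space. -/
theorem exists_seq_tendsto_sqrt (hsa : IsSelfAdjoint A) (hn : IsNonneg A)
    (hψ : ∀ j, ψ j ∈ hMinusTwo A) {B : H →ₗ.[ℂ] H} (hB : IsNonnegSqrt (addId A) B)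
    (w : B.domain)
    (hw : ∀ α (hα : defect A ψ α ∈ B.domain), inner ℂ (B ⟨_, hα⟩) (B w) = 0) :
    ∃ u : ℕ → A.domain, (∀ k j, ψ j (u k) = 0) ∧
      Tendsto (fun k => B ⟨u k, hB.mem_domain (u k)⟩) atTop (𝓝 (B w)) := by
  let F : (⨅ j, LinearMap.ker (ψ j) : Submodule ℂ A.domain) →ₗ[ℂ] H :=
    B.toFun ∘ₗ Submodule.inclusion (fun x hx => hB.mem_domain ⟨x, hx⟩ : A.domain ≤ B.domain) ∘ₗ
      Submodule.subtype _
  let M := LinearMap.range F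
  -- A vector `B x` orthogonal to `M` has `x` orthogonal to the range of `A_sym + I`, so `x` lies in
  -- the defect space and `hw` applies.
  have h1 : B w ∈ Mᗮᗮ := by
    rw [Submodule.mem_orthogonal]
    intro y hy
    obtain ⟨x, rfl⟩ := hB.surjective (addId_surjective hsa hn) y
    obtain ⟨α, hα⟩ := exists_eq_defect hsa hn hψ (x := (x : H)) fun u hu => by
      rw [← hB.inner_map]
      exact Submodule.inner_left_of_mem_orthogonal
        (⟨⟨u, (Submodule.mem_iInf _).2 hu⟩, rfl⟩ : B ⟨u, hB.mem_domain u⟩ ∈ M) hy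
    have hα' : defect A ψ α ∈ B.domain := hα ▸ x.2
    obtain rfl : x = ⟨_, hα'⟩ := Subtype.ext hα
    exact hw α hα'
  rw [Submodule.orthogonal_orthogonal_eq_closure] at h1
  obtain ⟨s, hs, hlim⟩ := mem_closure_iff_seq_limit.1 h1
  choose v hv using hs
  refine ⟨fun k => v k, fun k j => (Submodule.mem_iInf _).1 (v k).2 j, hlim.congr fun k => ?_⟩
  rw [← hv]; rfl

theorem norm_sum_smul_le {E : Type*} [SeminormedAddCommGroup E] [NormedSpace ℂ E]
    {x : Fin n → E} {b : Fin n → ℝ} (hx : ∀ j, ‖x j‖ ≤ b j) (γ : Fin n → ℂ) :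
    ‖∑ j, γ j • x j‖ ≤ (∑ j, b j) * ‖WithLp.toLp 2 γ‖ := by
  rw [Finset.sum_mul]
  refine (norm_sum_le _ _).trans (Finset.sum_le_sum fun j _ => ?_)
  rw [norm_smul, mul_comm]
  exact mul_le_mul (hx j) (PiLp.norm_apply_le (WithLp.toLp 2 γ) j) (norm_nonneg _)
    ((norm_nonneg _).trans (hx j))

theorem exists_norm_defect_le (A : H →ₗ.[ℂ] H) (ψ : Fin n → Module.Dual ℂ A.domain) :
    ∃ C : ℝ, ∀ γ, ‖defect A ψ γ‖ ≤ C * ‖WithLp.toLp 2 γ‖ :=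
  ⟨_, fun γ => norm_sum_smul_le (fun _ => le_rfl) γ⟩

/-- If `A_F` and `A_N` are transversal, then the elements of the defect space are bounded on
`D(A_sym)` in the form norm. -/
theorem exists_norm_inner_defect_le (hsa : IsSelfAdjoint A) (hn : IsNonneg A)
    (hψ : ∀ j, ψ j ∈ hMinusTwo A) (hd : Dense ((symRestriction A ψ).domain : Set H))
    (hS : IsNonneg (symRestriction A ψ))
    (h : Transversal (symRestriction A ψ) (friedrichs _ hS) (kreinVonNeumann _ hS)) :
    ∃ C : ℝ, ∀ γ, ∀ u : A.domain, (∀ j, ψ j u = 0) →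
      ‖inner ℂ (u : H) (defect A ψ γ)‖ ≤ C * ‖WithLp.toLp 2 γ‖ * √(qform A u) := by
  have h1 : ∀ j, ∃ C : ℝ, ∀ u : A.domain, (∀ j, ψ j u = 0) →
      ‖inner ℂ (u : H) (extResolvent A (ψ j))‖ ≤ C * √(qform A u) := fun j => by
    -- Since `A_sym* h_j = -h_j`, form-boundedness of `h_j` bounds `(h_j, u)` itself.
    obtain ⟨hf, e⟩ := assemble_mem_adjoint hsa hn hψ hd (0, Pi.single j 1)
    have e0 : assemble A ψ (0, Pi.single j 1) = extResolvent A (ψ j) := by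
      rw [assemble_eq, defect, Fintype.linearCombination_apply_single]
      simp
    obtain ⟨C, -, hC⟩ := exists_bound_of_transversal hd (symRestriction_isSymm hsa) hS h hf
    refine ⟨C, fun u hu => ?_⟩
    let v : (symRestriction A ψ).domain := ⟨u, (mem_symRestriction_domain_iff u).2 hu⟩
    have e1 : symRestriction A ψ v = A u := symRestriction_apply v
    have h2 := hC v
    have h3 := inner_adjoint hd ⟨_, hf⟩ v
    have e2 : addId A (0 : A.domain) = 0 := LinearPMap.map_zero _
    rw [e, e2, zero_sub, e1, inner_neg_left] at h3
    change _ = inner ℂ (assemble A ψ (0, Pi.single j 1)) (A u) at h3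
    rw [qform, e1, ← h3, norm_neg, norm_inner_symm, e0] at h2
    exact h2
  choose C hC using h1
  refine ⟨∑ j, C j, fun γ u hu => ?_⟩
  rw [defect, Fintype.linearCombination_apply, inner_sum]
  simp only [inner_smul_right]
  have h2 := norm_sum_smul_le (b := fun j => C j * √(qform A u)) (fun j => hC j u hu) γ
  rw [← Finset.sum_mul] at h2
  simp only [smul_eq_mul] at h2
  linarith

/-- The part of the defect space in the domain of `B`, in the coordinates `α`. -/
theorem exists_projection_defect (ψ : Fin n → Module.Dual ℂ A.domain) (B : H →ₗ.[ℂ] H) :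
    ∃ (P : (Fin n → ℂ) →ₗ[ℂ] (Fin n → ℂ)) (Y : (Fin n → ℂ) →ₗ[ℂ] H),
      (∀ α, defect A ψ α ∈ B.domain → P α = α) ∧
      ∀ α, ∃ hα : defect A ψ (P α) ∈ B.domain, Y α = B ⟨_, hα⟩ := by
  let N : Submodule ℂ (Fin n → ℂ) := B.domain.comap (defect A ψ)
  -- Any linear projection onto `N` will do; orthogonality is not required.
  obtain ⟨P, hP⟩ := LinearMap.exists_leftInverse_of_injective N.subtype N.ker_subtype
  let D : N →ₗ[ℂ] B.domain := (defect A ψ ∘ₗ N.subtype).codRestrict B.domain fun x => x.2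
  exact ⟨N.subtype ∘ₗ P, B.toFun ∘ₗ D ∘ₗ P,
    fun α hα => congrArg Subtype.val (congrArg (fun F : N →ₗ[ℂ] N => F ⟨α, hα⟩) hP),
    fun α => ⟨(P α).2, rfl⟩⟩

/-- A matrix that is the Gram matrix of the `h_j` on the part of the defect space in the energy
space, and vanishes against that part on the complement, is admissible. -/
theorem isAdmissibleMatrix_of_sum (hsa : IsSelfAdjoint A) (hn : IsNonneg A)
    (hψ : ∀ j, ψ j ∈ hMinusTwo A) {R : Matrix (Fin n) (Fin n) ℂ} (hR : R.IsHermitian)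
    (h : ∀ δ α (hδ : defect A ψ δ ∈ energySpace A) (hα : defect A ψ α ∈ energySpace A),
      ∑ j, (starRingEnd ℂ) (δ j) * R.mulVec α j =
        inner ℂ (opSqrt (addId A) ⟨_, hδ⟩) (opSqrt (addId A) ⟨_, hα⟩)) :
    IsAdmissibleMatrix A ψ R := by
  have hB := isNonnegSqrt_opSqrt_addId hsa hn
  refine ⟨hR, fun c hc => ?_⟩
  have hφ : (∑ j, c j • ψ j) ∈ hMinusTwo A :=
    Submodule.sum_mem _ fun j _ => Submodule.smul_mem _ _ (hψ j)
  have hh : extResolvent A (∑ j, c j • ψ j) ∈ energySpace A := by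
    obtain ⟨C, hC⟩ := hc
    refine hB.mem_domain_of_bound (addId_surjective hsa hn) (C := C) fun u => ?_
    rw [← extResolvent_spec hsa hn hφ]
    exact hC u
  refine ⟨hh, fun f hf _ p hp => ?_⟩
  have e := extResolvent_sum hsa hn hψ c
  have hδ : defect A ψ (fun j => (starRingEnd ℂ) (c j)) ∈ energySpace A := e ▸ hh
  -- Since `f` and `u` are in the energy space, so is the defect part. Thus only coefficients of
  -- that kind enter the admissibility condition.
  have hα : defect A ψ p.2 ∈ energySpace A := by
    have h1 : defect A ψ p.2 = f - p.1 := by rw [hp, assemble_eq]; abel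
    rw [h1]
    exact Submodule.sub_mem _ hf (hB.mem_domain p.1)
  have e1 : (⟨_, hh⟩ : energySpace A) = ⟨_, hδ⟩ := Subtype.ext e
  have e2 : (⟨f, hf⟩ : energySpace A) = ⟨_, hB.mem_domain p.1⟩ + ⟨_, hα⟩ := Subtype.ext hp
  rw [e1, e2, LinearPMap.map_add, inner_add_right, hB.inner_map, ← h _ _ hδ hα,
    inner_defect hsa hn hψ, ← Finset.sum_add_distrib]
  refine Finset.sum_congr rfl fun j _ => ?_
  rw [extFunctionals_apply, Complex.conj_conj, mul_add]

/-- The energy norm minus the norm, squared, controls the pairing with the defect space on the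
orthogonal complement in the energy space of its part there. -/
theorem norm_inner_defect_le_of_orthogonal (hsa : IsSelfAdjoint A) (hn : IsNonneg A)
    (hψ : ∀ j, ψ j ∈ hMinusTwo A) {B : H →ₗ.[ℂ] H} (hB : IsNonnegSqrt (addId A) B)
    {γ : Fin n → ℂ} {C : ℝ} (hC : ∀ u : A.domain, (∀ j, ψ j u = 0) →
      ‖inner ℂ (u : H) (defect A ψ γ)‖ ≤ C * √(qform A u)) (w : B.domain)
    (hw : ∀ α (hα : defect A ψ α ∈ B.domain), inner ℂ (B ⟨_, hα⟩) (B w) = 0) :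
    ‖inner ℂ (w : H) (defect A ψ γ)‖ ≤ C * √(‖B w‖ ^ 2 - ‖(w : H)‖ ^ 2) := by
  obtain ⟨u, hu, hlim⟩ := exists_seq_tendsto_sqrt hsa hn hψ hB w hw
  have h1 : Tendsto (fun k => (u k : H)) atTop (𝓝 (w : H)) := by
    rw [tendsto_iff_norm_sub_tendsto_zero] at hlim ⊢
    refine squeeze_zero (fun _ => norm_nonneg _) (fun k => ?_) hlim
    rw [← LinearPMap.map_sub]
    exact norm_le_norm_sqrt hsa hn hB (⟨u k, hB.mem_domain (u k)⟩ - w)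
  -- The bound passes to the limit along `D(A_sym)`, where `‖B u‖² - ‖u‖²` is exactly the form.
  refine le_of_tendsto_of_tendsto' (h1.inner tendsto_const_nhds).norm
    (((hlim.norm.pow 2).sub (h1.norm.pow 2)).sqrt.const_mul C) fun k => ?_
  rw [norm_sqrt_sq hB, add_sub_cancel_left]
  exact hC _ (hu k)

/-- Here `Ã f = (A + I) u - f`, and the kernel condition turns the pairing of the defect part with
`(A + I) u` into `-(α, R α)`. -/
theorem inner_matrixOperator (hsa : IsSelfAdjoint A) (hn : IsNonneg A)
    (hψ : ∀ j, ψ j ∈ hMinusTwo A) (hd : Dense ((symRestriction A ψ).domain : Set H))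
    {R : Matrix (Fin n) (Fin n) ℂ} (f : (matrixOperator A ψ R).domain)
    {p : A.domain × (Fin n → ℂ)} (hp : p ∈ LinearMap.ker (extFunctionals A ψ R))
    (hf : assemble A ψ p = f) :
    (inner ℂ (matrixOperator A ψ R f) (f : H)).re = (inner ℂ (p.1 : H) (addId A p.1)).re -
      (∑ j, (starRingEnd ℂ) (p.2 j) * R.mulVec p.2 j).re - ‖(f : H)‖ ^ 2 := by
  obtain ⟨hfd, e⟩ := assemble_mem_adjoint hsa hn hψ hd p
  have e1 : matrixOperator A ψ R f = addId A p.1 - f := by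
    have h1 : (⟨f, f.2.2⟩ : (symRestriction A ψ)†.domain) = ⟨_, hfd⟩ := Subtype.ext hf.symm
    rw [matrixOperator_apply, h1, e, hf]
  have h2 : inner ℂ (defect A ψ p.2) (addId A p.1) =
      -∑ j, (starRingEnd ℂ) (p.2 j) * R.mulVec p.2 j := by
    rw [inner_defect hsa hn hψ, ← Finset.sum_neg_distrib]
    refine Finset.sum_congr rfl fun j _ => ?_
    rw [(mem_ker_extFunctionals_iff R p).1 hp, mul_neg]
  have h3 : (inner ℂ (f : H) (f : H)).re = ‖(f : H)‖ ^ 2 := inner_self_eq_norm_sq (𝕜 := ℂ) _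
  have h4 : (inner ℂ (addId A p.1) (f : H)).re = (inner ℂ (f : H) (addId A p.1)).re :=
    inner_re_symm (𝕜 := ℂ) _ _
  have h5 : inner ℂ (f : H) (addId A p.1) =
      inner ℂ (p.1 : H) (addId A p.1) + inner ℂ (defect A ψ p.2) (addId A p.1) := by
    rw [← hf, assemble_eq, inner_add_left]
  rw [e1, inner_sub_left, Complex.sub_re, h3, h4, h5, h2, Complex.add_re, Complex.neg_re]
  ring

/-- If `A_F` and `A_N` are transversal, there is a nonnegative admissible operator. -/
theorem exists_isNonneg_of_transversal (hsa : IsSelfAdjoint A) (hn : IsNonneg A)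
    (hψ : ∀ j, ψ j ∈ hMinusTwo A) (hd : Dense ((symRestriction A ψ).domain : Set H))
    (hS : IsNonneg (symRestriction A ψ))
    (h : Transversal (symRestriction A ψ) (friedrichs _ hS) (kreinVonNeumann _ hS)) :
    ∃ T : H →ₗ.[ℂ] H, IsAdmissibleOperator A ψ T ∧ IsNonneg T := by
  have hB := isNonnegSqrt_opSqrt_addId hsa hn
  set B := opSqrt (addId A)
  obtain ⟨P, Y, hP, hY⟩ := exists_projection_defect ψ B
  obtain ⟨C, hC⟩ := exists_norm_inner_defect_le hsa hn hψ hd hS h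
  obtain ⟨C', hC'⟩ := exists_norm_defect_le A ψ
  let Z : (Fin n → ℂ) →ₗ[ℂ] EuclideanSpace ℂ (Fin n) :=
    (WithLp.linearEquiv 2 ℂ (Fin n → ℂ)).symm.toLinearMap ∘ₗ (LinearMap.id - P)
  have hZ : ∀ α, Z α = WithLp.toLp 2 (α - P α) := fun _ => rfl
  -- `C²` will pay for the cross term between `w` and the defect part outside the energy space, and
  -- `C'²` for the squared norm of that part.
  let R : Matrix (Fin n) (Fin n) ℂ := Matrix.gram ℂ (fun i => Y (Pi.single i 1)) -
    ((C ^ 2 + C' ^ 2 : ℝ) : ℂ) • Matrix.gram ℂ (fun i => Z (Pi.single i 1))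
  have hR : R.IsHermitian := by
    refine (Matrix.isHermitian_gram ℂ _).sub ?_
    rw [Matrix.IsHermitian, Matrix.conjTranspose_smul, (Matrix.isHermitian_gram ℂ _).eq,
      Complex.star_def, Complex.conj_ofReal]
  have hRs : ∀ δ α, ∑ j, (starRingEnd ℂ) (δ j) * R.mulVec α j =
      inner ℂ (Y δ) (Y α) - ((C ^ 2 + C' ^ 2 : ℝ) : ℂ) * inner ℂ (Z δ) (Z α) := fun δ α => by
    rw [← sum_gram_mulVec, ← sum_gram_mulVec, Finset.mul_sum, ← Finset.sum_sub_distrib]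
    refine Finset.sum_congr rfl fun j _ => ?_
    rw [Matrix.sub_mulVec, Matrix.smul_mulVec, Pi.sub_apply, Pi.smul_apply, smul_eq_mul]
    ring
  have hN : ∀ α (hα : defect A ψ α ∈ B.domain), Y α = B ⟨_, hα⟩ ∧ Z α = 0 := fun α hα => by
    obtain ⟨h1, h2⟩ := hY α
    refine ⟨?_, by rw [hZ, hP α hα, sub_self]; rfl⟩
    rw [h2]
    congr 1
    exact Subtype.ext (congrArg (defect A ψ) (hP α hα))
  refine ⟨matrixOperator A ψ R, ⟨R, isAdmissibleMatrix_of_sum hsa hn hψ hR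
    fun δ α hδ hα => ?_, rfl⟩, fun f => ?_⟩
  · rw [hRs, (hN δ hδ).1, (hN α hα).1, (hN δ hδ).2, inner_zero_left, mul_zero, sub_zero]
  obtain ⟨p, hp, hf⟩ := f.2.1
  obtain ⟨hPd, hYp⟩ := hY p.2
  rw [inner_matrixOperator hsa hn hψ hd f hp hf, hRs]
  let u : B.domain := ⟨p.1, hB.mem_domain p.1⟩
  let w : B.domain := u + ⟨_, hPd⟩
  have hBw : B w = B u + Y p.2 := by rw [hYp, ← LinearPMap.map_add]
  -- For `α` in the energy part, `Z α = 0`, so the kernel condition reads `(Y α, B u) = -(Y α, Y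
  -- p.2)`.
  have hw : ∀ α (hα : defect A ψ α ∈ B.domain), inner ℂ (B ⟨_, hα⟩) (B w) = 0 := fun α hα => by
    have h1 := hRs α p.2
    rw [(hN α hα).1, (hN α hα).2, inner_zero_left, mul_zero, sub_zero] at h1
    rw [hBw, inner_add_right, hB.inner_map ⟨_, hα⟩ p.1, inner_defect hsa hn hψ, ← h1,
      ← Finset.sum_add_distrib]
    refine Finset.sum_eq_zero fun j _ => ?_
    rw [(mem_ker_extFunctionals_iff R p).1 hp]
    ring
  set γ := p.2 - P p.2 with hγ
  have hfw : (f : H) = w + defect A ψ γ := by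
    rw [← hf, assemble_eq, hγ, map_sub]
    change _ = ((p.1 : H) + defect A ψ (P p.2)) + _
    abel
  have hq := norm_inner_defect_le_of_orthogonal hsa hn hψ hB (hC γ) w hw
  have ht0 : 0 ≤ ‖B w‖ ^ 2 - ‖(w : H)‖ ^ 2 :=
    sub_nonneg.2 (pow_le_pow_left₀ (norm_nonneg _) (norm_le_norm_sqrt hsa hn hB w) 2)
  have ht := Real.sq_sqrt ht0
  set t := √(‖B w‖ ^ 2 - ‖(w : H)‖ ^ 2)
  have hd' := pow_le_pow_left₀ (norm_nonneg _) (hC' γ) 2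
  have h1 : (inner ℂ (p.1 : H) (addId A p.1)).re = ‖B w‖ ^ 2 + ‖Y p.2‖ ^ 2 := by
    have h2 : B u = B w - Y p.2 := by rw [hBw, add_sub_cancel_right]
    have h3 : inner ℂ (p.1 : H) (addId A p.1) = inner ℂ (B u) (B u) := (hB.inner_map u p.1).symm
    have h4 : inner ℂ (Y p.2) (B w) = 0 := by rw [hYp]; exact hw _ hPd
    rw [h3, ← RCLike.re_eq_complex_re, inner_self_eq_norm_sq (𝕜 := ℂ), h2,
      norm_sub_sq (𝕜 := ℂ), inner_re_symm, h4]
    simp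
  have h5 : (inner ℂ (Y p.2) (Y p.2) - ((C ^ 2 + C' ^ 2 : ℝ) : ℂ) * inner ℂ (Z p.2) (Z p.2)).re =
      ‖Y p.2‖ ^ 2 - (C ^ 2 + C' ^ 2) * ‖WithLp.toLp 2 γ‖ ^ 2 := by
    rw [Complex.sub_re, Complex.re_ofReal_mul, ← RCLike.re_eq_complex_re,
      inner_self_eq_norm_sq (𝕜 := ℂ), inner_self_eq_norm_sq (𝕜 := ℂ), hZ]
  have h6 : ‖(f : H)‖ ^ 2 = ‖(w : H)‖ ^ 2 + 2 * (inner ℂ (w : H) (defect A ψ γ)).re +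
      ‖defect A ψ γ‖ ^ 2 := by
    rw [hfw]; exact norm_add_sq (𝕜 := ℂ) _ _
  have h7 : (inner ℂ (w : H) (defect A ψ γ)).re ≤ C * ‖WithLp.toLp 2 γ‖ * t :=
    (Complex.re_le_norm _).trans hq
  rw [h1, h5, h6]
  -- With `t² = ‖B w‖² - ‖w‖²` the form is at least `(t - C ‖γ‖)²` plus the nonnegative remainder
  -- `C'² ‖γ‖² - ‖defect γ‖²`.
  nlinarith [sq_nonneg (t - C * ‖WithLp.toLp 2 γ‖)]

end SingularPerturbation

end

theorem mainTheorem4 {H : Type*} [NormedAddCommGroup H] [InnerProductSpace ℂ H] [CompleteSpace H]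
    (A₀ : H →ₗ.[ℂ] H) (hsa : IsSelfAdjoint A₀) (hnn : SingularPerturbation.IsNonneg A₀)
    {n : ℕ} (ψ : Fin n → Module.Dual ℂ A₀.domain)
    (hψ : ∀ j, ψ j ∈ SingularPerturbation.hMinusTwo A₀)
    (hli : LinearIndependent ℂ ψ)
    (hind : Submodule.span ℂ (Set.range ψ) ⊓ SingularPerturbation.hZero A₀ = ⊥) :
    (∃ T : H →ₗ.[ℂ] H,
        SingularPerturbation.IsAdmissibleOperator A₀ ψ T ∧ SingularPerturbation.IsNonneg T) ↔
      SingularPerturbation.Transversal (SingularPerturbation.symRestriction A₀ ψ)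
        (SingularPerturbation.friedrichs (SingularPerturbation.symRestriction A₀ ψ)
          (SingularPerturbation.symRestriction_isNonneg hnn ψ))
        (SingularPerturbation.kreinVonNeumann (SingularPerturbation.symRestriction A₀ ψ)
          (SingularPerturbation.symRestriction_isNonneg hnn ψ)) := by
  have hd := SingularPerturbation.symRestriction_dense hsa hnn hψ hind
  constructor
  · rintro ⟨_, ⟨R, hR, rfl⟩, hT⟩
    exact SingularPerturbation.transversal_of_isNonneg hsa hnn hψ hli hd _ hR.1 hT
  · exact SingularPerturbation.exists_isNonneg_of_transversal hsa hnn hψ hd _
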